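/- Let $F,A\in\mathbb R^{m\times n}$, $H\in\mathbb R^{p\times n}$, let $Q_0,Q\in\mathbb R^{m\times m}$, $R\in\mathbb R^{p\times p}$ be symmetric positive definite, let $\ell\in\mathbb R^m$, $0<t_1\in\mathbb R$ and $I=[0,t_1]$. For symmetric matrices $S_0,S_1\in\mathbb R^{m\times m}$, $S_2\in\mathbb R^{p\times p}$ put $$\rho(g_0,g,h,\tau,S_0,S_1,S_2)=g_0^\top S_0g_0+\int_0^\tau\bigl(g^\top(t)S_1g(t)+h^\top(t)S_2h(t)\bigr)\,dt .$$ *Primal system.* A solution on $I$ is a tuple $(x,f,y,\eta)\in L^2(I,\mathbb R^n)\times L^2(I,\mathbb R^m)\times L^2(I,\mathbb R^p)\times L^2(I,\mathbb R^p)$ such that $Fx$ is absolutely continuous, $Fx(t)=Fx(0)+\int_0^t(Ax(s)+f(s))\,ds$ for all $t\in I$, and $y=Hx+\eta$ a.e. on $I$. It is admissible if $\rho(Fx(0),f,\eta,t,Q_0,Q,R)\le 1$ for all $t\in I$; let $\mathscr E(I)$ be the set of admissible solutions. For $U\in L^2(I,\mathbb R^p)$ let $$\sigma(U,\ell,t_1)=\sup_{(x,f,y,\eta)\in\mathscr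 E(I)}\Bigl(\ell^\top Fx(t_1)-\int_0^{t_1}y^\top(t)U(t)\,dt\Bigr)^2\in[0,+\infty].$$ $\widehat U\in L^2(I,\mathbb R^p)$ is a minimax observer on $I$ if $\sigma(\widehat U,\ell,t_1)=\inf_{U\in L^2(I,\mathbb R^p)}\sigma(U,\ell,t_1)<+\infty$. *Dual system.* For $T>0$ let $\mathscr D_\ell([0,T])$ be the set of $(q,u)\in L^2([0,T],\mathbb R^m)\times L^2([0,T],\mathbb R^p)$ such that $F^\top q$ is absolutely continuous, $F^\top q(t)=F^\top q(0)+\int_0^t(A^\top q(s)-H^\top u(s))\,ds$ for all $t\in[0,T]$, and $F^\top q(0)=F^\top\ell$. The tuple $(F,A,H)$ is $\ell$-impulse observable if $\mathscr D_\ell([0,T])\neq\varnothing$ for some $T>0$. With $M^+$ the Moore-Penrose pseudoinverse of a matrix $M$ and $\mathcal I_m$ the $m\times m$ identity matrix, let $P=\mathcal I_m-(F^\top)^+F^\top$, $\mathcal M_{opt}=P(PQ_0^{-1}P)^+PQ_0^{-1}(F^\top)^+$, $\bar Q_0=F((F^\top)^+-\mathcal M_{opt})^\top Q_0^{-1}((F^\top)^+-\mathcal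 M_{opt})F^\top$, and $$J(q,u,t_1)=\rho(q(t_1),q,u,t_1,\bar Q_0,Q^{-1},R^{-1}),\qquad (q,u)\in\mathscr D_\ell(I).$$ Let $\delta_{t_1}(v)(s)=v(t_1-s)$ for a.e. $s\in I$. The infimum of the empty set is $+\infty$. **Theorem.** The following statements are equivalent: (i) $(F,A,H)$ is $\ell$-impulse observable; (ii) there exists $U\in L^2(I,\mathbb R^p)$ such that $\sigma(U,\ell,t_1)<+\infty$; (iii) there exist a minimax observer $\widehat U$ on $I$ and a pair $(q^*,u^*)\in\mathscr D_\ell(I)$ such that $\widehat U=\delta_{t_1}(u^*)$ and $\sigma(\widehat U,\ell,t_1)=J^*_{t_1}:=J(q^*,u^*,t_1)=\inf_{(q,u)\in\mathscr D_\ell(I)}J(q,u,t_1)$. Moreover, for every $U\in L^2(I,\mathbb R^p)$, $$\sigma(U,\ell,t_1)=\inf_{(q,u)\in\mathscr D_\ell(I),\;u=\delta_{t_1}(U)}J(q,u,t_1),$$ and the set $\{(q,u)\in\mathscr D_\ell(I)\mid u=\delta_{t_1}(U)\}$ is nonempty if and only if $\sigma(U,\ell,t_1)<+\infty$. -/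

import Mathlib

open MeasureTheory

namespace MinimaxDAE

/-- `B` satisfies the four Penrose equations for the real matrix `A`. -/
structure IsMoorePenrose {a b : ℕ} (A : Matrix (Fin a) (Fin b) ℝ)
    (B : Matrix (Fin b) (Fin a) ℝ) : Prop where
  mul_mul_left : A * B * A = A
  mul_mul_right : B * A * B = B
  symm_left : (A * B).transpose = A * B
  symm_right : (B * A).transpose = B * A

theorem IsMoorePenrose.unique {a b : ℕ} {A : Matrix (Fin a) (Fin b) ℝ}
    {B C : Matrix (Fin b) (Fin a) ℝ} (hB : IsMoorePenrose A B) (hC : IsMoorePenrose A C) :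
    B = C := by
  have h1 : A * B = A * C := by
    have e : A * B = (A * C) * (A * B) := by
      rw [← Matrix.mul_assoc, hC.mul_mul_left]
    rw [← hB.symm_left, e, Matrix.transpose_mul, hB.symm_left, hC.symm_left, ← Matrix.mul_assoc,
      hB.mul_mul_left]
  have h2 : B * A = C * A := by
    have e : B * A = (B * A) * (C * A) := by
      rw [Matrix.mul_assoc, ← Matrix.mul_assoc A, hC.mul_mul_left]
    rw [← hB.symm_right, e, Matrix.transpose_mul, hB.symm_right, hC.symm_right, Matrix.mul_assoc,
      ← Matrix.mul_assoc A, hB.mul_mul_left]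
  rw [← hB.mul_mul_right, h2, Matrix.mul_assoc, h1, ← Matrix.mul_assoc, hC.mul_mul_right]

theorem exists_isMoorePenrose {a b : ℕ} (A : Matrix (Fin a) (Fin b) ℝ) :
    ∃ B : Matrix (Fin b) (Fin a) ℝ, IsMoorePenrose A B := by
  obtain ⟨S, hS⟩ : ∃ S, S = A.transpose * A := ⟨_, rfl⟩
  have hSh : S.IsHermitian := by
    rw [hS, ← Matrix.conjTranspose_eq_transpose_of_trivial]
    exact Matrix.isHermitian_conjTranspose_mul_self A
  obtain ⟨T, h1, h2, h3, h4⟩ : ∃ T : Matrix (Fin b) (Fin b) ℝ,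
      S * T * S = S ∧ T * S * T = T ∧ T.transpose = T ∧ T * S = S * T := by
    have hsp := hSh.spectral_theorem
    rw [Unitary.conjStarAlgAut_apply] at hsp
    obtain ⟨U, hU⟩ : ∃ U : Matrix (Fin b) (Fin b) ℝ, U = hSh.eigenvectorUnitary := ⟨_, rfl⟩
    obtain ⟨d, hd⟩ : ∃ d : Fin b → ℝ, d = hSh.eigenvalues := ⟨_, rfl⟩
    have hUU : star U * U = 1 := by
      rw [hU]; exact Unitary.coe_star_mul_self hSh.eigenvectorUnitary
    have hsp' : S = U * Matrix.diagonal d * star U := by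
      rw [hU, hd]; exact hsp
    have key : ∀ X Y : Matrix (Fin b) (Fin b) ℝ,
        (U * X * star U) * (U * Y * star U) = U * (X * Y) * star U := by
      intro X Y
      calc (U * X * star U) * (U * Y * star U) = U * X * (star U * U) * Y * star U := by
            simp only [Matrix.mul_assoc]
        _ = _ := by rw [hUU]; simp only [Matrix.mul_assoc, Matrix.mul_one]
    refine ⟨U * Matrix.diagonal (fun i => (d i)⁻¹) * star U, ?_, ?_, ?_, ?_⟩
    · rw [hsp', key, key]; simp [Matrix.diagonal_mul_diagonal]
    · rw [hsp', key, key, Matrix.diagonal_mul_diagonal, Matrix.diagonal_mul_diagonal]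
      have e : (fun i => (d i)⁻¹ * d i * (d i)⁻¹) = fun i => (d i)⁻¹ := by
        funext i
        by_cases h : d i = 0 <;> simp [h]
      rw [e]
    · simp [Matrix.star_eq_conjTranspose, Matrix.transpose_mul, Matrix.mul_assoc]
    · rw [hsp', key, key]; simp [Matrix.diagonal_mul_diagonal, mul_comm]
  have hSt : S.transpose = S := by rw [hS]; simp [Matrix.transpose_mul]
  have hTS : (T * S).transpose = T * S := by rw [Matrix.transpose_mul, h3, hSt, ← h4]
  have hz : A * (T * S) - A = 0 := by
    have : (A * (T * S) - A).transpose * (A * (T * S) - A) = 0 := by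
      rw [Matrix.transpose_sub, Matrix.transpose_mul, hTS]
      have e : A.transpose * (A * (T * S) - A) = 0 := by
        rw [Matrix.mul_sub, ← Matrix.mul_assoc, ← hS, ← Matrix.mul_assoc, h1, sub_self]
      rw [Matrix.sub_mul, Matrix.mul_assoc, e, Matrix.mul_zero, sub_zero]
    rw [← Matrix.conjTranspose_eq_transpose_of_trivial] at this
    exact Matrix.conjTranspose_mul_self_eq_zero.mp this
  refine ⟨T * A.transpose, ?_, ?_, ?_, ?_⟩
  · rw [Matrix.mul_assoc, Matrix.mul_assoc T, ← hS]; exact sub_eq_zero.mp hz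
  · rw [Matrix.mul_assoc T, ← hS, ← Matrix.mul_assoc, h2]
  · simp [Matrix.transpose_mul, h3, Matrix.mul_assoc]
  · rw [Matrix.mul_assoc, ← hS]; exact hTS

/-- The Moore-Penrose pseudoinverse `A⁺`: the unique solution of the four Penrose equations. -/
noncomputable def pinv {a b : ℕ} (A : Matrix (Fin a) (Fin b) ℝ) : Matrix (Fin b) (Fin a) ℝ :=
  (exists_isMoorePenrose A).choose

theorem pinv_spec {a b : ℕ} (A : Matrix (Fin a) (Fin b) ℝ) : IsMoorePenrose A (pinv A) :=
  (exists_isMoorePenrose A).choose_spec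

/-- Square integrable functions `[0, T] → ℝᵏ`. A function on `[0, T]` is represented by a function
on `ℝ` whose values outside `[0, T]` play no role. (All norms on `Fin k → ℝ` give the same space.) -/
def IsL2 {k : ℕ} (T : ℝ) (v : ℝ → Fin k → ℝ) : Prop :=
  MemLp v 2 (volume.restrict (Set.Icc 0 T))

/-- Equality almost everywhere on `[0, T]`. -/
def EqAE {k : ℕ} (T : ℝ) (v w : ℝ → Fin k → ℝ) : Prop :=
  v =ᵐ[volume.restrict (Set.Icc 0 T)] w

/-- Time reversal `δ_T(v)(s) = v(T - s)`. -/
def reversal {k : ℕ} (T : ℝ) (v : ℝ → Fin k → ℝ) : ℝ → Fin k → ℝ := fun s => v (T - s)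

/-- `ρ(g₀, g, h, τ, S₀, S₁, S₂) = g₀ᵀ S₀ g₀ + ∫₀^τ (gᵀ S₁ g + hᵀ S₂ h) dt`. -/
noncomputable def rho {m p : ℕ} (g₀ : Fin m → ℝ) (g : ℝ → Fin m → ℝ) (h : ℝ → Fin p → ℝ) (τ : ℝ)
    (S₀ S₁ : Matrix (Fin m) (Fin m) ℝ) (S₂ : Matrix (Fin p) (Fin p) ℝ) : ℝ :=
  g₀ ⬝ᵥ S₀.mulVec g₀ + ∫ t in (0 : ℝ)..τ, (g t ⬝ᵥ S₁.mulVec (g t) + h t ⬝ᵥ S₂.mulVec (h t))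

/-- `(x, f, y, η)` solves `d(Fx)/dt = Ax + f`, `y = Hx + η` on `[0, T]`. -/
structure IsSolution {m n p : ℕ} (F A : Matrix (Fin m) (Fin n) ℝ) (H : Matrix (Fin p) (Fin n) ℝ)
    (T : ℝ) (x : ℝ → Fin n → ℝ) (f : ℝ → Fin m → ℝ) (y η : ℝ → Fin p → ℝ) : Prop where
  x_mem : IsL2 T x
  f_mem : IsL2 T f
  y_mem : IsL2 T y
  eta_mem : IsL2 T η
  abs_cont : AbsolutelyContinuousOnInterval (fun t => F.mulVec (x t)) 0 T
  state_eq : ∀ t ∈ Set.Icc (0 : ℝ) T,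
    F.mulVec (x t) = F.mulVec (x 0) + ∫ s in (0 : ℝ)..t, (A.mulVec (x s) + f s)
  output_eq : EqAE T y (fun t => H.mulVec (x t) + η t)

/-- Admissible solutions on `[0, T]`: initial value and disturbances in the unit ellipsoid. -/
structure IsAdmissible {m n p : ℕ} (F A : Matrix (Fin m) (Fin n) ℝ) (H : Matrix (Fin p) (Fin n) ℝ)
    (Q₀ Q : Matrix (Fin m) (Fin m) ℝ) (R : Matrix (Fin p) (Fin p) ℝ)
    (T : ℝ) (x : ℝ → Fin n → ℝ) (f : ℝ → Fin m → ℝ) (y η : ℝ → Fin p → ℝ) : Prop where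
  solution : IsSolution F A H T x f y η
  bound : ∀ t ∈ Set.Icc (0 : ℝ) T, rho (F.mulVec (x 0)) f η t Q₀ Q R ≤ 1

/-- The estimate `∫₀^T yᵀ(t) U(t) dt` produced from the output `y` by `U`. -/
noncomputable def estimate {p : ℕ} (T : ℝ) (U y : ℝ → Fin p → ℝ) : ℝ :=
  ∫ t in (0 : ℝ)..T, y t ⬝ᵥ U t

/-- The worst-case estimation error `σ(U, ℓ, T)`, with values in the extended reals. -/
noncomputable def worstCaseError {m n p : ℕ} (F A : Matrix (Fin m) (Fin n) ℝ)
    (H : Matrix (Fin p) (Fin n) ℝ) (Q₀ Q : Matrix (Fin m) (Fin m) ℝ)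
    (R : Matrix (Fin p) (Fin p) ℝ) (ℓ : Fin m → ℝ) (T : ℝ) (U : ℝ → Fin p → ℝ) : EReal :=
  sSup {e : EReal | ∃ x f y η, IsAdmissible F A H Q₀ Q R T x f y η ∧
    e = (((ℓ ⬝ᵥ F.mulVec (x T) - estimate T U y) ^ 2 : ℝ) : EReal)}

/-- `U` is a minimax observer on `[0, T]`: it is square integrable, its worst-case error is the
infimum of the worst-case errors over all of `L²`, and this infimum is finite. -/
structure IsMinimaxObserver {m n p : ℕ} (F A : Matrix (Fin m) (Fin n) ℝ)
    (H : Matrix (Fin p) (Fin n) ℝ) (Q₀ Q : Matrix (Fin m) (Fin m) ℝ)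
    (R : Matrix (Fin p) (Fin p) ℝ) (ℓ : Fin m → ℝ) (T : ℝ) (U : ℝ → Fin p → ℝ) : Prop where
  mem : IsL2 T U
  eq_inf : worstCaseError F A H Q₀ Q R ℓ T U =
    sInf {e : EReal | ∃ V, IsL2 T V ∧ e = worstCaseError F A H Q₀ Q R ℓ T V}
  finite : worstCaseError F A H Q₀ Q R ℓ T U < ⊤

/-- `(q, u)` solves the dual equation `d(Fᵀq)/dt = Aᵀq - Hᵀu` on `[0, T]`. -/
structure IsDualSolution {m n p : ℕ} (F A : Matrix (Fin m) (Fin n) ℝ)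
    (H : Matrix (Fin p) (Fin n) ℝ) (T : ℝ) (q : ℝ → Fin m → ℝ) (u : ℝ → Fin p → ℝ) : Prop where
  q_mem : IsL2 T q
  u_mem : IsL2 T u
  abs_cont : AbsolutelyContinuousOnInterval (fun t => F.transpose.mulVec (q t)) 0 T
  state_eq : ∀ t ∈ Set.Icc (0 : ℝ) T,
    F.transpose.mulVec (q t) = F.transpose.mulVec (q 0) +
      ∫ s in (0 : ℝ)..t, (A.transpose.mulVec (q s) - H.transpose.mulVec (u s))

/-- The set `𝒟_ℓ([0, T])` of dual solutions `(q, u)` with `Fᵀq(0) = Fᵀℓ`. -/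
def dualSet {m n p : ℕ} (F A : Matrix (Fin m) (Fin n) ℝ) (H : Matrix (Fin p) (Fin n) ℝ)
    (ℓ : Fin m → ℝ) (T : ℝ) : Set ((ℝ → Fin m → ℝ) × (ℝ → Fin p → ℝ)) :=
  {z | IsDualSolution F A H T z.1 z.2 ∧ F.transpose.mulVec (z.1 0) = F.transpose.mulVec ℓ}

/-- `ℓ`-impulse observability: `𝒟_ℓ([0, T])` is nonempty for some `T > 0`. -/
def IsImpulseObservable {m n p : ℕ} (F A : Matrix (Fin m) (Fin n) ℝ)
    (H : Matrix (Fin p) (Fin n) ℝ) (ℓ : Fin m → ℝ) : Prop :=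
  ∃ T : ℝ, 0 < T ∧ (dualSet F A H ℓ T).Nonempty

/-- `P = I - (Fᵀ)⁺ Fᵀ`. -/
noncomputable def projP {m n : ℕ} (F : Matrix (Fin m) (Fin n) ℝ) : Matrix (Fin m) (Fin m) ℝ :=
  1 - pinv F.transpose * F.transpose

/-- `M_opt = P (P Q₀⁻¹ P)⁺ P Q₀⁻¹ (Fᵀ)⁺`. -/
noncomputable def mOpt {m n : ℕ} (F : Matrix (Fin m) (Fin n) ℝ) (Q₀ : Matrix (Fin m) (Fin m) ℝ) :
    Matrix (Fin m) (Fin n) ℝ :=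
  projP F * pinv (projP F * Q₀⁻¹ * projP F) * projP F * Q₀⁻¹ * pinv F.transpose

/-- `Q̄₀ = F ((Fᵀ)⁺ - M_opt)ᵀ Q₀⁻¹ ((Fᵀ)⁺ - M_opt) Fᵀ`. -/
noncomputable def barQ₀ {m n : ℕ} (F : Matrix (Fin m) (Fin n) ℝ) (Q₀ : Matrix (Fin m) (Fin m) ℝ) :
    Matrix (Fin m) (Fin m) ℝ :=
  F * (pinv F.transpose - mOpt F Q₀).transpose * Q₀⁻¹ * (pinv F.transpose - mOpt F Q₀) *
    F.transpose

/-- The dual cost `J(q, u, T) = ρ(q(T), q, u, T, Q̄₀, Q⁻¹, R⁻¹)`. -/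
noncomputable def dualCost {m n p : ℕ} (F : Matrix (Fin m) (Fin n) ℝ)
    (Q₀ Q : Matrix (Fin m) (Fin m) ℝ) (R : Matrix (Fin p) (Fin p) ℝ) (T : ℝ)
    (q : ℝ → Fin m → ℝ) (u : ℝ → Fin p → ℝ) : ℝ :=
  rho (q T) q u T (barQ₀ F Q₀) Q⁻¹ R⁻¹

/-- The infimum in the extended reals of the dual cost over a set of pairs `(q, u)`; it is `+∞` for
the empty set. -/
noncomputable def infDualCost {m n p : ℕ} (F : Matrix (Fin m) (Fin n) ℝ)
    (Q₀ Q : Matrix (Fin m) (Fin m) ℝ) (R : Matrix (Fin p) (Fin p) ℝ) (T : ℝ)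
    (D : Set ((ℝ → Fin m → ℝ) × (ℝ → Fin p → ℝ))) : EReal :=
  sInf {e : EReal | ∃ z ∈ D, e = (dualCost F Q₀ Q R T z.1 z.2 : EReal)}

/-- The set of `(q, u) ∈ 𝒟_ℓ([0, T])` with `u = δ_T(U)` almost everywhere. -/
def dualSetWithInput {m n p : ℕ} (F A : Matrix (Fin m) (Fin n) ℝ) (H : Matrix (Fin p) (Fin n) ℝ)
    (ℓ : Fin m → ℝ) (T : ℝ) (U : ℝ → Fin p → ℝ) : Set ((ℝ → Fin m → ℝ) × (ℝ → Fin p → ℝ)) :=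
  {z | z ∈ dualSet F A H ℓ T ∧ EqAE T z.2 (reversal T U)}

end MinimaxDAE

/-! The estimation error `ℓᵀFx(T) - ∫ yᵀU` depends linearly on the solution, and admissibility is a
unit-ball condition on the data `(Fx(0), f, η)` in the Hilbert norm with weights `Q₀, Q, R`. Hence
`σ(U, ℓ, T)` is the squared norm of a linear functional of the data, and the theorem is Riesz
duality: the dual norm carries the inverse weights, and the representing vectors are time-reversed
dual solutions.

Upper bound (`sq_error_le_dualCost`): integrating a dual solution against a primal one
(`IsDualSolution.duality`) writes the error as a pairing of dual and primal data, and Cauchy-Schwarz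
bounds it by `J`. Only `Fᵀq(T)` meets `x(0)`, so the terminal weight is the minimum of the `Q₀⁻¹`
form over vectors with that image; this minimum is `barQ₀` (`barQ₀_le`).

Lower bound (`exists_dualCost_le_of_worstCaseError_le`): if `σ` is finite, the relation between data
and error is single valued and bounded, hence represented by some `(w₀, w, b)`. Pure noise forces `b
= -U`. Noise-free solutions give an identity in weak form, and `exists_mem_dualSet_of_weak` recovers
from it a dual solution equal a.e. to the reversal of `w`. Thus `σ(U, ℓ, T)` is the attained minimum
of `J` over dual solutions with control `δ_T(U)`.

A minimum over all controls exists because the weak form of the dual system cuts out a closed affine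
subset of a Hilbert space, which has a point of least norm (`exists_dualCost_min`). Finally,
solvability of the dual system does not depend on the horizon: the span of one trajectory of `Fᵀq`
is invariant under a suitable linear feedback, which generates solutions on every interval
(`IsImpulseObservable.dualSet_nonempty`). -/

namespace MinimaxDAE

/-! ### Vector-valued primitives and integration by parts -/

theorem absolutelyContinuousOnInterval_pi {k : ℕ} {f : ℝ → Fin k → ℝ} {a b : ℝ}
    (h : ∀ i, AbsolutelyContinuousOnInterval (fun t => f t i) a b) :
    AbsolutelyContinuousOnInterval f a b := by
  -- Absolute continuity unfolds to convergence of sums of distances to zero; a distance in the sup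
  -- norm is dominated by the sum of the coordinate distances.
  have hs := tendsto_finsetSum Finset.univ (fun i _ => h i)
  simp only [Finset.sum_const_zero] at hs
  refine squeeze_zero (fun E => Finset.sum_nonneg fun _ _ => dist_nonneg) (fun E => ?_) hs
  rw [Finset.sum_comm]
  refine Finset.sum_le_sum fun j _ => ?_
  refine (dist_pi_le_iff (Finset.sum_nonneg fun _ _ => dist_nonneg)).2 fun i => ?_
  exact Finset.single_le_sum (f := fun i => dist (f (E.2 j).1 i) (f (E.2 j).2 i))
    (fun _ _ => dist_nonneg) (Finset.mem_univ i)

theorem integral_apply {k : ℕ} {h : ℝ → Fin k → ℝ} {a b : ℝ}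
    (hh : IntervalIntegrable h volume a b) (i : Fin k) :
    (∫ s in a..b, h s) i = ∫ s in a..b, h s i :=
  ((ContinuousLinearMap.proj (R := ℝ) (φ := fun _ : Fin k => ℝ) i).intervalIntegral_comp_comm
    hh).symm

theorem intervalIntegrable_apply {k : ℕ} {h : ℝ → Fin k → ℝ} {a b : ℝ}
    (hh : IntervalIntegrable h volume a b) (i : Fin k) :
    IntervalIntegrable (fun s => h s i) volume a b :=
  ⟨hh.1.eval i, hh.2.eval i⟩

theorem absolutelyContinuousOnInterval_integral {k : ℕ} {f h : ℝ → Fin k → ℝ} {T : ℝ} (hT : 0 ≤ T)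
    (hh : IntervalIntegrable h volume 0 T) (c : Fin k → ℝ)
    (hf : ∀ t ∈ Set.Icc 0 T, f t = c + ∫ s in (0 : ℝ)..t, h s) :
    AbsolutelyContinuousOnInterval f 0 T := by
  refine absolutelyContinuousOnInterval_pi fun i => ?_
  have h1 := (intervalIntegrable_apply hh i).absolutelyContinuousOnInterval_intervalIntegral
    (c := 0) (by simp)
  rw [absolutelyContinuousOnInterval_iff] at h1 ⊢
  intro ε hε
  obtain ⟨δ, hδ, h2⟩ := h1 ε hε
  refine ⟨δ, hδ, fun E hE hs => ?_⟩
  refine lt_of_eq_of_lt (Finset.sum_congr rfl fun j hj => ?_) (h2 E hE hs)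
  have hm := hE.1 j hj
  rw [Set.uIcc_of_le hT] at hm
  have key : ∀ t ∈ Set.Icc 0 T, f t i = c i + ∫ s in (0 : ℝ)..t, h s i := fun t ht => by
    rw [hf t ht, Pi.add_apply, integral_apply (hh.mono_set ?_)]
    rw [Set.uIcc_of_le ht.1, Set.uIcc_of_le hT]
    exact Set.Icc_subset_Icc_right ht.2
  rw [key _ hm.1, key _ hm.2, dist_add_left]

/-- The integrand of a primitive with values in a subspace has values in that subspace. -/
theorem ae_mem_of_integral_mem {k : ℕ} (W : Submodule ℝ (Fin k → ℝ)) {h : ℝ → Fin k → ℝ} {T : ℝ}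
    (hT : 0 ≤ T) (hh : IntervalIntegrable h volume 0 T)
    (hW : ∀ t ∈ Set.Icc 0 T, ∫ s in (0 : ℝ)..t, h s ∈ W) :
    ∀ᵐ t ∂volume.restrict (Set.Icc 0 T), h t ∈ W := by
  rw [← restrict_Ioo_eq_restrict_Icc, ae_restrict_iff' measurableSet_Ioo]
  filter_upwards [hh.ae_hasDerivAt_integral] with t ht hmem
  -- At almost every point the primitive has derivative `h t`, a limit of difference quotients that
  -- lie in the closed subspace `W`.
  have hd := ht (by rw [Set.uIcc_of_le hT]; exact Set.Ioo_subset_Icc_self hmem) 0 (by simp)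
  rw [hasDerivAt_iff_tendsto_slope] at hd
  refine W.closed_of_finiteDimensional.mem_of_tendsto hd ?_
  have : Set.Ioo 0 T ∈ nhds t := Ioo_mem_nhds hmem.1 hmem.2
  filter_upwards [nhdsWithin_le_nhds this] with s hs
  rw [slope_def_module]
  exact W.smul_mem _ (W.sub_mem (hW _ (Set.Ioo_subset_Icc_self hs))
    (hW _ (Set.Ioo_subset_Icc_self hmem)))

/-- The primitive formulas are required on all of `ℝ`, so that `X` and `Y` may be replaced by them
before differentiating. -/
theorem integral_by_parts {a b : ℝ → ℝ} {T : ℝ} (X Y : ℝ → ℝ)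
    (ha : IntervalIntegrable a volume 0 T) (hb : IntervalIntegrable b volume 0 T)
    (hX : ∀ t, X t = X 0 + ∫ s in (0 : ℝ)..t, a s)
    (hY : ∀ t, Y t = Y 0 + ∫ s in (0 : ℝ)..t, b s) :
    ∫ t in (0 : ℝ)..T, (a t * Y t + X t * b t) = X T * Y T - X 0 * Y 0 := by
  have ac : ∀ {a X : ℝ → ℝ}, IntervalIntegrable a volume 0 T →
      (∀ t, X t = X 0 + ∫ s in (0 : ℝ)..t, a s) → AbsolutelyContinuousOnInterval X 0 T := by
    intro a X ha hX
    have h1 := ha.absolutelyContinuousOnInterval_intervalIntegral (c := 0) (by simp)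
    rw [absolutelyContinuousOnInterval_iff] at h1 ⊢
    convert! h1 using 10
    rw [hX, hX (Prod.snd _), dist_add_left]
  have de : ∀ {a X : ℝ → ℝ}, IntervalIntegrable a volume 0 T →
      (∀ t, X t = X 0 + ∫ s in (0 : ℝ)..t, a s) →
      ∀ᵐ t, t ∈ Set.uIcc 0 T → deriv X t = a t := by
    intro a X ha hX
    filter_upwards [ha.ae_hasDerivAt_integral] with t h1 h2
    have := (h1 h2 0 (by simp)).const_add (X 0)
    rw [funext hX]
    exact this.deriv
  rw [← (ac ha hX).integral_deriv_mul_eq_sub (ac hb hY)]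
  refine intervalIntegral.integral_congr_ae ?_
  filter_upwards [de ha hX, de hb hY] with t h1 h2 h3
  rw [h1 (Set.uIoc_subset_uIcc h3), h2 (Set.uIoc_subset_uIcc h3)]

theorem integral_by_parts_dotProduct {k : ℕ} {a b X Y : ℝ → Fin k → ℝ} {T : ℝ} (hT : 0 ≤ T)
    (ha : IntervalIntegrable a volume 0 T) (hb : IntervalIntegrable b volume 0 T)
    (hX : ∀ t ∈ Set.Icc 0 T, X t = X 0 + ∫ s in (0 : ℝ)..t, a s)
    (hY : ∀ t ∈ Set.Icc 0 T, Y t = Y 0 + ∫ s in (0 : ℝ)..t, b s) :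
    ∫ t in (0 : ℝ)..T, (a t ⬝ᵥ Y t + X t ⬝ᵥ b t) = X T ⬝ᵥ Y T - X 0 ⬝ᵥ Y 0 := by
  have comp : ∀ {a X : ℝ → Fin k → ℝ}, IntervalIntegrable a volume 0 T →
      (∀ t ∈ Set.Icc 0 T, X t = X 0 + ∫ s in (0 : ℝ)..t, a s) → ∀ t ∈ Set.Icc 0 T, ∀ i,
      X t i = X 0 i + ∫ s in (0 : ℝ)..t, a s i := by
    intro a X ha hX t ht i
    rw [hX t ht, Pi.add_apply, integral_apply (ha.mono_set ?_)]
    rw [Set.uIcc_of_le ht.1, Set.uIcc_of_le hT]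
    exact Set.Icc_subset_Icc_right ht.2
  have cont : ∀ {a X : ℝ → Fin k → ℝ}, IntervalIntegrable a volume 0 T → ∀ i,
      ContinuousOn (fun t => X 0 i + ∫ s in (0 : ℝ)..t, a s i) (Set.uIcc 0 T) := by
    intro a X ha i
    exact continuousOn_const.add
      (intervalIntegral.continuousOn_primitive_interval' (intervalIntegrable_apply ha i) (by simp))
  -- Globally defined primitives, agreeing with the coordinates of `X` and `Y` on `[0, T]` only.
  let X' : Fin k → ℝ → ℝ := fun i t => X 0 i + ∫ s in (0 : ℝ)..t, a s i
  let Y' : Fin k → ℝ → ℝ := fun i t => Y 0 i + ∫ s in (0 : ℝ)..t, b s i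
  have key : ∀ i, ∫ t in (0 : ℝ)..T, (a t i * Y' i t + X' i t * b t i) =
      X' i T * Y' i T - X' i 0 * Y' i 0 := fun i =>
    integral_by_parts (X' i) (Y' i) (intervalIntegrable_apply ha i) (intervalIntegrable_apply hb i)
      (fun t => by simp [X']) (fun t => by simp [Y'])
  calc ∫ t in (0 : ℝ)..T, (a t ⬝ᵥ Y t + X t ⬝ᵥ b t)
      = ∫ t in (0 : ℝ)..T, ∑ i, (a t i * Y' i t + X' i t * b t i) := by
        refine intervalIntegral.integral_congr fun t ht => ?_
        rw [Set.uIcc_of_le hT] at ht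
        simp only [dotProduct, ← Finset.sum_add_distrib]
        refine Finset.sum_congr rfl fun i _ => ?_
        rw [comp ha hX t ht i, comp hb hY t ht i]
    _ = ∑ i, ∫ t in (0 : ℝ)..T, (a t i * Y' i t + X' i t * b t i) := by
        refine intervalIntegral.integral_finsetSum fun i _ => ?_
        exact ((intervalIntegrable_apply ha i).mul_continuousOn (cont hb i)).add
          ((intervalIntegrable_apply hb i).continuousOn_mul (cont ha i))
    _ = X T ⬝ᵥ Y T - X 0 ⬝ᵥ Y 0 := by
        simp only [key, dotProduct, ← Finset.sum_sub_distrib]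
        refine Finset.sum_congr rfl fun i _ => ?_
        rw [comp ha hX T ⟨hT, le_rfl⟩ i, comp hb hY T ⟨hT, le_rfl⟩ i]
        simp [X', Y']

/-! ### Square integrable functions and time reversal -/

section SquareIntegrable

variable {k l : ℕ} {T : ℝ} {v w : ℝ → Fin k → ℝ}

theorem IsL2.add (hv : IsL2 T v) (hw : IsL2 T w) : IsL2 T (fun t => v t + w t) := MemLp.add hv hw

theorem IsL2.sub (hv : IsL2 T v) (hw : IsL2 T w) : IsL2 T (fun t => v t - w t) := MemLp.sub hv hw

theorem IsL2.neg (hv : IsL2 T v) : IsL2 T (fun t => -v t) := MemLp.neg hv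

theorem IsL2.smul (c : ℝ) (hv : IsL2 T v) : IsL2 T (fun t => c • v t) := MemLp.const_smul hv c

theorem IsL2.zero : IsL2 T (fun _ => (0 : Fin k → ℝ)) := MemLp.zero'

theorem IsL2.mulVec (M : Matrix (Fin l) (Fin k) ℝ) (hv : IsL2 T v) :
    IsL2 T (fun t => M.mulVec (v t)) :=
  (LinearMap.toContinuousLinearMap M.mulVecLin).comp_memLp' hv

theorem IsL2.congr (hv : IsL2 T v) (h : EqAE T v w) : IsL2 T w := (memLp_congr_ae h).1 hv

theorem IsL2.of_continuousOn (hv : ContinuousOn v (Set.Icc 0 T)) : IsL2 T v := by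
  obtain ⟨C, hC⟩ := isCompact_Icc.exists_bound_of_continuousOn hv
  refine MemLp.of_bound (hv.aestronglyMeasurable measurableSet_Icc) C ?_
  exact (ae_restrict_iff' measurableSet_Icc).2 (Filter.Eventually.of_forall hC)

theorem IsL2.intervalIntegrable (hT : 0 ≤ T) (hv : IsL2 T v) : IntervalIntegrable v volume 0 T := by
  rw [intervalIntegrable_iff_integrableOn_Icc_of_le hT]
  exact hv.integrable (by norm_num)

theorem IsL2.intervalIntegrable_dotProduct (hT : 0 ≤ T) (hv : IsL2 T v) (hw : IsL2 T w) :
    IntervalIntegrable (fun t => v t ⬝ᵥ w t) volume 0 T := by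
  rw [intervalIntegrable_iff_integrableOn_Icc_of_le hT]
  exact integrable_finsetSum _ fun i _ => MemLp.integrable_mul (hv.eval i) (hw.eval i)

theorem measurePreserving_reversal :
    MeasurePreserving (fun s => T - s) (volume.restrict (Set.Icc 0 T))
      (volume.restrict (Set.Icc 0 T)) := by
  have h := (Measure.measurePreserving_sub_left volume T).restrict_preimage
    (measurableSet_Icc (a := (0 : ℝ)) (b := T))
  simpa using h

theorem IsL2.reversal (hv : IsL2 T v) : IsL2 T (reversal T v) :=
  hv.comp_measurePreserving measurePreserving_reversal

theorem EqAE.reversal (h : EqAE T v w) :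
    EqAE T (MinimaxDAE.reversal T v) (MinimaxDAE.reversal T w) :=
  measurePreserving_reversal.quasiMeasurePreserving.ae_eq_comp h

theorem reversal_reversal (v : ℝ → Fin k → ℝ) : reversal T (reversal T v) = v := by
  funext s; simp [MinimaxDAE.reversal]

theorem EqAE.symm (h : EqAE T v w) : EqAE T w v := Filter.EventuallyEq.symm h

theorem integral_congr_of_ae {f g : ℝ → ℝ} (hT : 0 ≤ T)
    (h : ∀ᵐ t ∂volume.restrict (Set.Icc 0 T), f t = g t) :
    ∫ t in (0 : ℝ)..T, f t = ∫ t in (0 : ℝ)..T, g t := by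
  rw [intervalIntegral.integral_of_le hT, intervalIntegral.integral_of_le hT,
    ← integral_Icc_eq_integral_Ioc, ← integral_Icc_eq_integral_Ioc]
  exact integral_congr_ae h

end SquareIntegrable

theorem mulVec_intervalIntegral {k l : ℕ} (M : Matrix (Fin l) (Fin k) ℝ) {h : ℝ → Fin k → ℝ}
    {a b : ℝ} (hh : IntervalIntegrable h volume a b) :
    M.mulVec (∫ s in a..b, h s) = ∫ s in a..b, M.mulVec (h s) :=
  ((LinearMap.toContinuousLinearMap M.mulVecLin).intervalIntegral_comp_comm hh).symm

theorem intervalIntegrable_mulVec {k l : ℕ} (M : Matrix (Fin l) (Fin k) ℝ) {h : ℝ → Fin k → ℝ}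
    {a b : ℝ} (hh : IntervalIntegrable h volume a b) :
    IntervalIntegrable (fun s => M.mulVec (h s)) volume a b :=
  ⟨(LinearMap.toContinuousLinearMap M.mulVecLin).integrable_comp hh.1,
    (LinearMap.toContinuousLinearMap M.mulVecLin).integrable_comp hh.2⟩

theorem transpose_mulVec_dotProduct {k l : ℕ} (M : Matrix (Fin k) (Fin l) ℝ) (a : Fin k → ℝ)
    (b : Fin l → ℝ) : M.transpose.mulVec a ⬝ᵥ b = a ⬝ᵥ M.mulVec b := by
  rw [Matrix.mulVec_transpose, Matrix.dotProduct_mulVec]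

theorem primitive_reversal {k : ℕ} {X g : ℝ → Fin k → ℝ} {T : ℝ} (hT : 0 ≤ T)
    (hg : IntervalIntegrable g volume 0 T)
    (hX : ∀ t ∈ Set.Icc 0 T, X t = X 0 + ∫ s in (0 : ℝ)..t, g s) :
    ∀ t ∈ Set.Icc 0 T, X (T - t) = X T + ∫ s in (0 : ℝ)..t, -g (T - s) := by
  intro t ht
  have hs : ∀ s ∈ Set.Icc 0 T, IntervalIntegrable g volume 0 s := fun s hs => hg.mono_set (by
    rw [Set.uIcc_of_le hs.1, Set.uIcc_of_le hT]; exact Set.Icc_subset_Icc_right hs.2)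
  have ht' : T - t ∈ Set.Icc 0 T := ⟨by linarith [ht.2], by linarith [ht.1]⟩
  rw [intervalIntegral.integral_neg, intervalIntegral.integral_comp_sub_left (fun s => g s) T,
    hX _ ht', hX T ⟨hT, le_rfl⟩, sub_zero,
    ← intervalIntegral.integral_add_adjacent_intervals (hs _ ht')
      ((hs _ ht').symm.trans (hs T ⟨hT, le_rfl⟩))]
  abel

/-- The distance to the closed set `W` is continuous along `X` and vanishes almost everywhere, hence
everywhere on `[0, T]`. -/
theorem forall_mem_of_ae_mem {k : ℕ} (W : Submodule ℝ (Fin k → ℝ)) {X : ℝ → Fin k → ℝ} {T : ℝ}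
    (hT : 0 < T) (hX : ContinuousOn X (Set.Icc 0 T))
    (h : ∀ᵐ t ∂volume.restrict (Set.Icc 0 T), X t ∈ W) : ∀ t ∈ Set.Icc 0 T, X t ∈ W := by
  have hc : ContinuousOn (fun t => Metric.infDist (X t) (W : Set (Fin k → ℝ))) (Set.Icc 0 T) :=
    (Metric.continuous_infDist_pt _).comp_continuousOn hX
  have hmem : ∀ v, v ∈ W ↔ Metric.infDist v (W : Set (Fin k → ℝ)) = 0 := fun v =>
    W.closed_of_finiteDimensional.mem_iff_infDist_zero ⟨0, W.zero_mem⟩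
  have := Measure.eqOn_Icc_of_ae_eq volume hT.ne
    (h.mono fun t ht => (hmem _).1 ht) hc continuousOn_const
  exact fun t ht => (hmem _).2 (this ht)

/-! ### Duality between primal and dual solutions -/

section

variable {m n p : ℕ} {F A : Matrix (Fin m) (Fin n) ℝ} {H : Matrix (Fin p) (Fin n) ℝ} {T : ℝ}

theorem IsSolution.rhs_mem {x : ℝ → Fin n → ℝ} {f : ℝ → Fin m → ℝ} {y η : ℝ → Fin p → ℝ}
    (h : IsSolution F A H T x f y η) : IsL2 T (fun s => A.mulVec (x s) + f s) :=
  (h.x_mem.mulVec A).add h.f_mem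

theorem IsDualSolution.rhs_mem {q : ℝ → Fin m → ℝ} {u : ℝ → Fin p → ℝ}
    (h : IsDualSolution F A H T q u) :
    IsL2 T (fun s => A.transpose.mulVec (q s) - H.transpose.mulVec (u s)) :=
  (h.q_mem.mulVec _).sub (h.u_mem.mulVec _)

theorem IsSolution.ae_mem_range {x : ℝ → Fin n → ℝ} {f : ℝ → Fin m → ℝ} {y η : ℝ → Fin p → ℝ}
    (hT : 0 ≤ T) (h : IsSolution F A H T x f y η) :
    ∀ᵐ t ∂volume.restrict (Set.Icc 0 T), A.mulVec (x t) + f t ∈ F.mulVecLin.range := by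
  refine ae_mem_of_integral_mem _ hT (h.rhs_mem.intervalIntegrable hT) fun t ht => ?_
  rw [← sub_eq_iff_eq_add'.2 (h.state_eq t ht), ← Matrix.mulVec_sub]
  exact ⟨_, rfl⟩

theorem IsDualSolution.ae_mem_range {q : ℝ → Fin m → ℝ} {u : ℝ → Fin p → ℝ}
    (hT : 0 ≤ T) (h : IsDualSolution F A H T q u) :
    ∀ᵐ t ∂volume.restrict (Set.Icc 0 T),
      A.transpose.mulVec (q t) - H.transpose.mulVec (u t) ∈ F.transpose.mulVecLin.range := by
  refine ae_mem_of_integral_mem _ hT (h.rhs_mem.intervalIntegrable hT) fun t ht => ?_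
  rw [← sub_eq_iff_eq_add'.2 (h.state_eq t ht), ← Matrix.mulVec_sub]
  exact ⟨_, rfl⟩

/-- Integration by parts pairing a solution of the primal system with a solution of the dual one. -/
theorem IsDualSolution.duality {x : ℝ → Fin n → ℝ} {f : ℝ → Fin m → ℝ} {y η : ℝ → Fin p → ℝ}
    {q : ℝ → Fin m → ℝ} {u : ℝ → Fin p → ℝ} (hT : 0 ≤ T) (hq : IsDualSolution F A H T q u)
    (h : IsSolution F A H T x f y η) :
    F.transpose.mulVec (q 0) ⬝ᵥ x T - F.transpose.mulVec (q T) ⬝ᵥ x 0 =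
      ∫ t in (0 : ℝ)..T, (reversal T q t ⬝ᵥ f t + reversal T u t ⬝ᵥ H.mulVec (x t)) := by
  have hG := (pinv_spec F).mul_mul_left
  set G := pinv F
  have hg := hq.rhs_mem.intervalIntegrable hT
  have hr := primitive_reversal hT hg hq.state_eq
  -- Only `Fx` is absolutely continuous, not `x`. Against vectors in the range of `Fᵀ`, however, `x`
  -- may be replaced by `F⁺Fx`, which can be integrated by parts.
  have key : ∀ (a : Fin m → ℝ) (z : Fin n → ℝ),
      F.transpose.mulVec a ⬝ᵥ G.mulVec (F.mulVec z) = F.transpose.mulVec a ⬝ᵥ z := by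
    intro a z
    rw [transpose_mulVec_dotProduct, transpose_mulVec_dotProduct, Matrix.mulVec_mulVec,
      Matrix.mulVec_mulVec, hG]
  have hf := h.rhs_mem.intervalIntegrable hT
  have ibp := integral_by_parts_dotProduct (X := fun t => F.transpose.mulVec (q (T - t)))
    (a := fun t => -(A.transpose.mulVec (q (T - t)) - H.transpose.mulVec (u (T - t))))
    (Y := fun t => G.mulVec (F.mulVec (x t))) (b := fun t => G.mulVec (A.mulVec (x t) + f t)) hT
    (hq.rhs_mem.reversal.neg.intervalIntegrable hT)
    (intervalIntegrable_mulVec G hf)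
    (fun t ht => by rw [hr t ht, sub_zero]) (fun t ht => by
      rw [h.state_eq t ht, Matrix.mulVec_add, mulVec_intervalIntegral]
      refine hf.mono_set ?_
      rw [Set.uIcc_of_le ht.1, Set.uIcc_of_le hT]
      exact Set.Icc_subset_Icc_right ht.2)
  simp only [sub_self, sub_zero, key] at ibp
  rw [← ibp]
  -- Almost everywhere the derivatives of `Fx` and `Fᵀq` lie in the ranges of `F` and `Fᵀ`, so `F⁺`
  -- can be removed again and the terms in `A` cancel.
  refine integral_congr_of_ae hT ?_
  filter_upwards [h.ae_mem_range hT,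
    measurePreserving_reversal.quasiMeasurePreserving.ae (hq.ae_mem_range hT)] with t h1 h2
  obtain ⟨z, hz⟩ := h1
  obtain ⟨s, hs⟩ := h2
  rw [Matrix.mulVecLin_apply] at hz hs
  have e1 : F.transpose.mulVec (q (T - t)) ⬝ᵥ G.mulVec (A.mulVec (x t) + f t) =
      q (T - t) ⬝ᵥ (A.mulVec (x t) + f t) := by
    rw [← hz, key, transpose_mulVec_dotProduct]
  have e2 : (A.transpose.mulVec (q (T - t)) - H.transpose.mulVec (u (T - t))) ⬝ᵥ
      G.mulVec (F.mulVec (x t)) =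
      (A.transpose.mulVec (q (T - t)) - H.transpose.mulVec (u (T - t))) ⬝ᵥ x t := by
    rw [← hs, key]
  rw [neg_dotProduct, e1, e2, sub_dotProduct, transpose_mulVec_dotProduct,
    transpose_mulVec_dotProduct, dotProduct_add]
  simp only [reversal]
  ring

/-- A pair representing `x ↦ ℓᵀ F x(T)` along the primal solutions is a time-reversed dual
solution. -/
theorem exists_mem_dualSet_of_weak {ℓ w₀ : Fin m → ℝ} {w : ℝ → Fin m → ℝ} {U : ℝ → Fin p → ℝ}
    (hT : 0 < T) (hw : IsL2 T w) (hU : IsL2 T U)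
    (h : ∀ x f, IsSolution F A H T x f (fun t => H.mulVec (x t)) (fun _ => 0) →
      ℓ ⬝ᵥ F.mulVec (x T) = w₀ ⬝ᵥ F.mulVec (x 0) +
        ∫ t in (0 : ℝ)..T, (w t ⬝ᵥ f t + U t ⬝ᵥ H.mulVec (x t))) :
    ∃ q, EqAE T q (reversal T w) ∧ (q, reversal T U) ∈ dualSet F A H ℓ T ∧
      F.transpose.mulVec (q T) = F.transpose.mulVec w₀ := by
  have hT' := hT.le
  have hTT : T ∈ Set.Icc 0 T := ⟨hT', le_rfl⟩
  have h0T : (0 : ℝ) ∈ Set.Icc 0 T := ⟨le_rfl, hT'⟩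
  let g : ℝ → Fin n → ℝ := fun t => H.transpose.mulVec (U t) - A.transpose.mulVec (w t)
  have hgL : IsL2 T g := (hU.mulVec _).sub (hw.mulVec _)
  have hg := hgL.intervalIntegrable hT'
  let K : Fin n → ℝ := ∫ s in (0 : ℝ)..T, g s
  let Γ : ℝ → Fin n → ℝ := fun t => K + ∫ s in (0 : ℝ)..t, -g s
  have primCont : ∀ {k : ℕ} {v : ℝ → Fin k → ℝ} (c : Fin k → ℝ), IsL2 T v →
      ContinuousOn (fun t => c + ∫ s in (0 : ℝ)..t, v s) (Set.Icc 0 T) := by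
    intro k v c hv
    rw [← Set.uIcc_of_le hT']
    exact continuousOn_const.add (intervalIntegral.continuousOn_primitive_interval'
      (hv.intervalIntegrable hT') (by simp))
  have hΓc : ContinuousOn Γ (Set.Icc 0 T) := primCont K hgL.neg
  have hΓT : Γ T = 0 := by simp [Γ, K]
  have hΓ0 : Γ 0 = K := by simp [Γ]
  let c : Fin n → ℝ := F.transpose.mulVec ℓ
  -- With `Γ(t) = ∫ₜᵀ g`, the dual equation to be proved is `Fᵀw = c - Γ` a.e., and the boundary
  -- condition is `Fᵀw₀ = c - K`. The residuals of the two are `r` and `d`. The hypothesis is tested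
  -- on the solution with `x' = r` and `x(0) = -d`, chosen so that it becomes `∫ |r|² = -|d|²`.
  let r : ℝ → Fin n → ℝ := fun t => F.transpose.mulVec (w t) + (Γ t - c)
  have hr : IsL2 T r :=
    (hw.mulVec _).add ((IsL2.of_continuousOn hΓc).sub (IsL2.of_continuousOn continuousOn_const))
  let d : Fin n → ℝ := c - F.transpose.mulVec w₀ - K
  let x : ℝ → Fin n → ℝ := fun t => -d + ∫ s in (0 : ℝ)..t, r s
  have hx : IsL2 T x := IsL2.of_continuousOn (primCont _ hr)
  have hx0 : x 0 = -d := by simp [x]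
  have hxs : ∀ t, x t = x 0 + ∫ s in (0 : ℝ)..t, r s := fun t => by rw [hx0]
  -- The disturbance is free, so every absolutely continuous `x` with square integrable derivative
  -- is a primal trajectory for this `f`.
  let f : ℝ → Fin m → ℝ := fun t => F.mulVec (r t) - A.mulVec (x t)
  have hf : IsL2 T f := (hr.mulVec _).sub (hx.mulVec _)
  have hri := hr.intervalIntegrable hT'
  have hst : ∀ t ∈ Set.Icc (0 : ℝ) T,
      F.mulVec (x t) = F.mulVec (x 0) + ∫ s in (0 : ℝ)..t, (A.mulVec (x s) + f s) := by
    intro t ht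
    rw [hxs t, Matrix.mulVec_add, mulVec_intervalIntegral]
    · simp [f]
    · refine hri.mono_set ?_
      rw [Set.uIcc_of_le ht.1, Set.uIcc_of_le hT']
      exact Set.Icc_subset_Icc_right ht.2
  have hsol : IsSolution F A H T x f (fun t => H.mulVec (x t)) (fun _ => 0) :=
    { x_mem := hx
      f_mem := hf
      y_mem := hx.mulVec _
      eta_mem := IsL2.zero
      abs_cont := absolutelyContinuousOnInterval_integral hT'
        (((hx.mulVec A).add hf).intervalIntegrable hT') _ hst
      state_eq := hst
      output_eq := by simp [EqAE] }
  have hmain := h x f hsol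
  have ibp := integral_by_parts_dotProduct hT' hri (hgL.neg.intervalIntegrable hT')
    (fun t _ => hxs t) (Y := Γ) (fun t _ => by rw [hΓ0])
  rw [hΓT, hΓ0, hx0, dotProduct_zero] at ibp
  have hcr : c ⬝ᵥ x T = c ⬝ᵥ (-d) + ∫ t in (0 : ℝ)..T, c ⬝ᵥ r t := by
    rw [hxs T, hx0, dotProduct_add]
    congr 1
    exact (((LinearMap.toContinuousLinearMap (dotProductBilin ℝ ℝ c)).intervalIntegral_comp_comm
      hri).symm :)
  have hconst : IsL2 T (fun _ => c) := IsL2.of_continuousOn continuousOn_const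
  have hrr : ∫ t in (0 : ℝ)..T, r t ⬝ᵥ r t = -(d ⬝ᵥ d) := by
    have e : ∫ t in (0 : ℝ)..T, r t ⬝ᵥ r t =
        (∫ t in (0 : ℝ)..T, (w t ⬝ᵥ f t + U t ⬝ᵥ H.mulVec (x t))) +
        (∫ t in (0 : ℝ)..T, (r t ⬝ᵥ Γ t + x t ⬝ᵥ -g t)) - ∫ t in (0 : ℝ)..T, c ⬝ᵥ r t := by
      rw [← intervalIntegral.integral_add, ← intervalIntegral.integral_sub]
      · refine intervalIntegral.integral_congr fun t _ => ?_
        have e1 : w t ⬝ᵥ F.mulVec (r t) = r t ⬝ᵥ F.transpose.mulVec (w t) := by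
          rw [← transpose_mulVec_dotProduct, dotProduct_comm]
        have e2 : w t ⬝ᵥ A.mulVec (x t) = x t ⬝ᵥ A.transpose.mulVec (w t) := by
          rw [← transpose_mulVec_dotProduct, dotProduct_comm]
        have e3 : U t ⬝ᵥ H.mulVec (x t) = x t ⬝ᵥ H.transpose.mulVec (U t) := by
          rw [← transpose_mulVec_dotProduct, dotProduct_comm]
        have e4 : r t ⬝ᵥ r t = r t ⬝ᵥ F.transpose.mulVec (w t) + (r t ⬝ᵥ Γ t - r t ⬝ᵥ c) := by
          rw [← dotProduct_sub, ← dotProduct_add]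
        simp only [f, g, dotProduct_sub, dotProduct_neg, e1, e2, e3, e4, dotProduct_comm c]
        ring
      · exact ((hw.intervalIntegrable_dotProduct hT' hf).add
          (hU.intervalIntegrable_dotProduct hT' (hx.mulVec H))).add
          ((hr.intervalIntegrable_dotProduct hT' (IsL2.of_continuousOn hΓc)).add
          (hx.intervalIntegrable_dotProduct hT' hgL.neg))
      · exact hconst.intervalIntegrable_dotProduct hT' hr
      · exact (hw.intervalIntegrable_dotProduct hT' hf).add
          (hU.intervalIntegrable_dotProduct hT' (hx.mulVec H))
      · exact (hr.intervalIntegrable_dotProduct hT' (IsL2.of_continuousOn hΓc)).add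
          (hx.intervalIntegrable_dotProduct hT' hgL.neg)
    rw [e, ibp]
    rw [← transpose_mulVec_dotProduct, ← transpose_mulVec_dotProduct, hcr, hx0] at hmain
    have e5 : d ⬝ᵥ d = c ⬝ᵥ d - F.transpose.mulVec w₀ ⬝ᵥ d - d ⬝ᵥ K := by
      rw [dotProduct_comm d K, ← sub_dotProduct, ← sub_dotProduct]
    rw [e5]
    simp only [dotProduct_neg, neg_dotProduct] at hmain ⊢
    linarith
  have hdd : 0 ≤ d ⬝ᵥ d := Finset.sum_nonneg fun i _ => mul_self_nonneg _
  have hrr0 : 0 ≤ ∫ t in (0 : ℝ)..T, r t ⬝ᵥ r t :=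
    intervalIntegral.integral_nonneg hT' fun t _ => Finset.sum_nonneg fun i _ => mul_self_nonneg _
  have hd : d = 0 := dotProduct_self_eq_zero.1 (by linarith)
  have hcK : c - K = F.transpose.mulVec w₀ := by
    rw [← sub_eq_zero, ← hd]; simp only [d]; abel
  have hr0 : ∀ᵐ t ∂volume.restrict (Set.Icc 0 T), r t = 0 := by
    have hz : ∫ t in (0 : ℝ)..T, r t ⬝ᵥ r t = 0 := by linarith
    rw [intervalIntegral.integral_of_le hT', ← integral_Icc_eq_integral_Ioc,
      integral_eq_zero_iff_of_nonneg] at hz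
    · filter_upwards [hz] with t ht
      exact dotProduct_self_eq_zero.1 ht
    · exact fun t => Finset.sum_nonneg fun i _ => mul_self_nonneg _
    · exact (intervalIntegrable_iff_integrableOn_Icc_of_le hT').1
        (hr.intervalIntegrable_dotProduct hT' hr)
  -- The continuous representative of `Fᵀw`; by continuity it takes values in the range of `Fᵀ` at
  -- every time.
  let C : ℝ → Fin n → ℝ := fun t => c - Γ t
  have hCw : ∀ᵐ t ∂volume.restrict (Set.Icc 0 T), C t = F.transpose.mulVec (w t) := by
    filter_upwards [hr0] with t ht
    have : F.transpose.mulVec (w t) + (Γ t - c) = 0 := ht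
    rw [← sub_eq_zero, ← neg_eq_zero, ← this]
    simp only [C]; abel
  have hCrange := forall_mem_of_ae_mem F.transpose.mulVecLin.range hT
    (X := C) (continuousOn_const.sub hΓc)
    (hCw.mono fun t ht => ⟨w t, by rw [ht]; rfl⟩)
  have hC0 : C 0 = F.transpose.mulVec w₀ := by rw [← hcK, ← hΓ0]
  have hCT : C T = F.transpose.mulVec ℓ := by simp only [C, hΓT, sub_zero, c]
  have hCs : ∀ t ∈ Set.Icc 0 T, C t = C 0 + ∫ s in (0 : ℝ)..t, g s := by
    intro t _
    simp only [C, hΓ0]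
    simp only [Γ, intervalIntegral.integral_neg]
    abel
  let G := pinv F.transpose
  have hG : F.transpose * G * F.transpose = F.transpose := (pinv_spec F.transpose).mul_mul_left
  -- Changes `w` on a null set so that `Fᵀv = C` holds at every point of `[0, T]`, as a dual
  -- solution must satisfy its equation pointwise.
  let v : ℝ → Fin m → ℝ := fun t => w t + G.mulVec (C t - F.transpose.mulVec (w t))
  have hv : ∀ t ∈ Set.Icc 0 T, F.transpose.mulVec (v t) = C t := by
    intro t ht
    obtain ⟨z, hz⟩ := hCrange t ht
    rw [Matrix.mulVecLin_apply] at hz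
    simp only [v]
    rw [← hz, ← Matrix.mulVec_sub, Matrix.mulVec_add, Matrix.mulVec_mulVec, Matrix.mulVec_mulVec,
      hG, Matrix.mulVec_sub, add_sub_cancel]
  have hvw : EqAE T v w := by
    filter_upwards [hCw] with t ht
    simp [v, ht]
  have hqw : EqAE T (reversal T v) (reversal T w) := hvw.reversal
  have hvL : IsL2 T v := hw.congr hvw.symm
  have hrev := primitive_reversal hT' hg hCs
  have hmem : ∀ t ∈ Set.Icc 0 T, T - t ∈ Set.Icc 0 T := fun t ht =>
    ⟨by linarith [ht.2], by linarith [ht.1]⟩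
  have hq0 : F.transpose.mulVec (reversal T v 0) = F.transpose.mulVec ℓ := by
    simp only [reversal]
    rw [sub_zero, hv T hTT, hCT]
  have hqs : ∀ t ∈ Set.Icc (0 : ℝ) T, F.transpose.mulVec (reversal T v t) =
      F.transpose.mulVec (reversal T v 0) + ∫ s in (0 : ℝ)..t,
        (A.transpose.mulVec (reversal T v s) - H.transpose.mulVec (reversal T U s)) := by
    intro t ht
    have e := hrev t ht
    rw [hq0]
    simp only [reversal] at hqw ⊢
    rw [hv _ (hmem t ht), e, hCT]
    congr 1
    refine intervalIntegral.integral_congr_ae ?_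
    have := (ae_restrict_iff' measurableSet_Icc).1 hqw
    filter_upwards [this] with s hs hst
    rw [Set.uIoc_of_le ht.1] at hst
    have hs' : v (T - s) = w (T - s) := hs ⟨hst.1.le, hst.2.trans ht.2⟩
    rw [hs']
    simp only [g]
    abel
  refine ⟨reversal T v, hqw, ⟨⟨hvL.reversal, hU.reversal, ?_, hqs⟩, hq0⟩, ?_⟩
  · exact absolutelyContinuousOnInterval_integral hT'
      (((hvL.reversal.mulVec _).sub (hU.reversal.mulVec _)).intervalIntegrable hT') _ hqs
  · simp only [reversal]
    rw [sub_self, hv 0 h0T, hC0]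

end

/-! ### Independence of the horizon -/

section

variable {m n p : ℕ} {F A : Matrix (Fin m) (Fin n) ℝ} {H : Matrix (Fin p) (Fin n) ℝ}
  {ℓ : Fin m → ℝ}

theorem exists_hasDerivAt_linear {E : Type*} [NormedAddCommGroup E] [NormedSpace ℝ E]
    [CompleteSpace E] (M : E →L[ℝ] E) (z₀ : E) :
    ∃ z : ℝ → E, z 0 = z₀ ∧ ∀ t, HasDerivAt z (M (z t)) t := by
  refine ⟨fun t => NormedSpace.exp (t • M) z₀, by simp, fun t => ?_⟩
  exact (hasDerivAt_exp_smul_const' (𝕂 := ℝ) M t).clm_apply (hasDerivAt_const t z₀)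
    |>.congr_deriv (by simp)

/-- A subspace that is invariant for the dual system up to control carries dual solutions on every
interval. -/
theorem dualSet_nonempty_of_invariant (W : Submodule ℝ (Fin n → ℝ))
    (hW : ∀ z ∈ W, ∃ v u, F.transpose.mulVec v = z ∧
      A.transpose.mulVec v - H.transpose.mulVec u ∈ W)
    (hℓ : F.transpose.mulVec ℓ ∈ W) {T : ℝ} (hT : 0 ≤ T) : (dualSet F A H ℓ T).Nonempty := by
  let Φ : ((Fin m → ℝ) × (Fin p → ℝ)) →ₗ[ℝ] (Fin n → ℝ) :=
    F.transpose.mulVecLin ∘ₗ LinearMap.fst ℝ _ _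
  let Ψ : ((Fin m → ℝ) × (Fin p → ℝ)) →ₗ[ℝ] (Fin n → ℝ) :=
    A.transpose.mulVecLin ∘ₗ LinearMap.fst ℝ _ _ - H.transpose.mulVecLin ∘ₗ LinearMap.snd ℝ _ _
  let Y : Submodule ℝ ((Fin m → ℝ) × (Fin p → ℝ)) := W.comap Φ ⊓ W.comap Ψ
  let φ : Y →ₗ[ℝ] W := (Φ.comp Y.subtype).codRestrict W fun y => y.2.1
  let ψ : Y →ₗ[ℝ] W := (Ψ.comp Y.subtype).codRestrict W fun y => y.2.2
  -- Invariance says that `φ` is onto `W`. A linear right inverse is a feedback choosing `(v, u)`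
  -- from the state, and the dual equation becomes the linear ODE `z' = ψ (g z)` on `W`.
  obtain ⟨g, hg⟩ := φ.exists_rightInverse_of_surjective (by
    rw [LinearMap.range_eq_top]
    rintro ⟨z, hz⟩
    obtain ⟨v, u, h1, h2⟩ := hW z hz
    refine ⟨⟨(v, u), ?_, h2⟩, Subtype.ext h1⟩
    change F.transpose.mulVec v ∈ W
    rwa [h1])
  let M : W →L[ℝ] W := LinearMap.toContinuousLinearMap (ψ ∘ₗ g)
  obtain ⟨z, hz0, hz⟩ := exists_hasDerivAt_linear M ⟨_, hℓ⟩
  have hzc : Continuous z := continuous_iff_continuousAt.2 fun t => (hz t).continuousAt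
  have hgc : Continuous fun t => (g (z t) : (Fin m → ℝ) × (Fin p → ℝ)) :=
    continuous_subtype_val.comp (g.continuous_of_finiteDimensional.comp hzc)
  have hφ : ∀ t, F.transpose.mulVec (g (z t) : (Fin m → ℝ) × (Fin p → ℝ)).1 = z t := fun t =>
    congrArg Subtype.val (LinearMap.congr_fun hg (z t))
  have hqL : IsL2 T fun t => (g (z t) : (Fin m → ℝ) × (Fin p → ℝ)).1 :=
    IsL2.of_continuousOn (continuous_fst.comp hgc).continuousOn
  have huL : IsL2 T fun t => (g (z t) : (Fin m → ℝ) × (Fin p → ℝ)).2 :=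
    IsL2.of_continuousOn (continuous_snd.comp hgc).continuousOn
  have hrhs := (hqL.mulVec A.transpose).sub (huL.mulVec H.transpose)
  have hst : ∀ t ∈ Set.Icc (0 : ℝ) T,
      F.transpose.mulVec (g (z t) : (Fin m → ℝ) × (Fin p → ℝ)).1 =
      F.transpose.mulVec (g (z 0) : (Fin m → ℝ) × (Fin p → ℝ)).1 + ∫ s in (0 : ℝ)..t,
        (A.transpose.mulVec (g (z s) : (Fin m → ℝ) × (Fin p → ℝ)).1 -
          H.transpose.mulVec (g (z s) : (Fin m → ℝ) × (Fin p → ℝ)).2) := by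
    intro t ht
    rw [hφ, hφ, intervalIntegral.integral_eq_sub_of_hasDerivAt (f := fun s => (z s : Fin n → ℝ))]
    · abel
    · intro s _
      exact W.subtypeL.hasFDerivAt.comp_hasDerivAt s (hz s)
    · refine (hrhs.intervalIntegrable hT).mono_set ?_
      rw [Set.uIcc_of_le ht.1, Set.uIcc_of_le hT]
      exact Set.Icc_subset_Icc_right ht.2
  refine ⟨(fun t => (g (z t) : (Fin m → ℝ) × (Fin p → ℝ)).1,
    fun t => (g (z t) : (Fin m → ℝ) × (Fin p → ℝ)).2), ⟨hqL, huL, ?_, hst⟩, ?_⟩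
  · exact absolutelyContinuousOnInterval_integral hT (hrhs.intervalIntegrable hT) _ hst
  · rw [hφ, hz0]

/-- The span of the values of one trajectory of `Fᵀq` is invariant up to control, because the
derivative of the trajectory stays in it a.e. -/
theorem IsImpulseObservable.dualSet_nonempty (h : IsImpulseObservable F A H ℓ) {t₁ : ℝ}
    (ht₁ : 0 ≤ t₁) : (dualSet F A H ℓ t₁).Nonempty := by
  obtain ⟨T, hT, ⟨q, u⟩, hq, hq0⟩ := h
  simp only at hq hq0
  let W : Submodule ℝ (Fin n → ℝ) :=
    Submodule.span ℝ ((fun t => F.transpose.mulVec (q t)) '' Set.Icc 0 T)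
  have hqW : ∀ t ∈ Set.Icc 0 T, F.transpose.mulVec (q t) ∈ W := fun t ht =>
    Submodule.subset_span ⟨t, ht, rfl⟩
  let Φ : ((Fin m → ℝ) × (Fin p → ℝ)) →ₗ[ℝ] (Fin n → ℝ) :=
    F.transpose.mulVecLin ∘ₗ LinearMap.fst ℝ _ _
  let Ψ : ((Fin m → ℝ) × (Fin p → ℝ)) →ₗ[ℝ] (Fin n → ℝ) :=
    A.transpose.mulVecLin ∘ₗ LinearMap.fst ℝ _ _ - H.transpose.mulVecLin ∘ₗ LinearMap.snd ℝ _ _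
  have hae := ae_mem_of_integral_mem W hT.le (hq.rhs_mem.intervalIntegrable hT.le) fun t ht => by
    rw [← sub_eq_iff_eq_add'.2 (hq.state_eq t ht)]
    exact W.sub_mem (hqW t ht) (hqW 0 ⟨le_rfl, hT.le⟩)
  -- Almost every `q(t), u(t)` witnesses invariance at the state `Fᵀq(t)`. The states having a
  -- witness form a subspace, so continuity covers every `t`, and linearity then covers the span.
  have hS := forall_mem_of_ae_mem ((W.comap Ψ).map Φ) hT (X := fun t => F.transpose.mulVec (q t))
    (by simpa only [Set.uIcc_of_le hT.le] using hq.abs_cont.continuousOn)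
    (hae.mono fun t ht => ⟨(q t, u t), ht, rfl⟩)
  refine dualSet_nonempty_of_invariant W (fun z hz => ?_)
    (hq0 ▸ hqW 0 ⟨le_rfl, hT.le⟩) ht₁
  have : W ≤ (W.comap Ψ).map Φ := Submodule.span_le.2 (by rintro _ ⟨t, ht, rfl⟩; exact hS t ht)
  obtain ⟨⟨v, u⟩, h1, h2⟩ := this hz
  exact ⟨v, u, h2, h1⟩

end

/-! ### The terminal weight as a minimum over fibres of `Fᵀ` -/

section Weights

open scoped MatrixOrder in
theorem _root_.Matrix.PosDef.exists_transpose_mul_self {k : ℕ} {Q : Matrix (Fin k) (Fin k) ℝ}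
    (hQ : Q.PosDef) : ∃ B : Matrix (Fin k) (Fin k) ℝ, IsUnit B ∧ B.transpose * B = Q := by
  obtain ⟨B, hB⟩ := CStarAlgebra.nonneg_iff_eq_star_mul_self.1 hQ.posSemidef.nonneg
  rw [Matrix.star_eq_conjTranspose, Matrix.conjTranspose_eq_transpose_of_trivial] at hB
  exact ⟨B, isUnit_of_mul_isUnit_right (hB ▸ hQ.isUnit), hB.symm⟩

variable {m n : ℕ} (F : Matrix (Fin m) (Fin n) ℝ) {Q₀ : Matrix (Fin m) (Fin m) ℝ}

theorem transpose_mul_projP : F.transpose * projP F = 0 := by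
  rw [projP, Matrix.mul_sub, Matrix.mul_one, ← Matrix.mul_assoc,
    (pinv_spec F.transpose).mul_mul_left, sub_self]

theorem projP_transpose : (projP F).transpose = projP F := by
  rw [projP, Matrix.transpose_sub, (pinv_spec F.transpose).symm_right, Matrix.transpose_one]

/-- The values of `mOpt` lie in the kernel of `Fᵀ`, so subtracting it from the pseudoinverse leaves
a generalized inverse of `Fᵀ`. -/
theorem transpose_mul_pinv_sub_mOpt :
    F.transpose * (pinv F.transpose - mOpt F Q₀) * F.transpose = F.transpose := by
  rw [Matrix.mul_sub, Matrix.sub_mul, (pinv_spec F.transpose).mul_mul_left, mOpt]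
  simp only [← Matrix.mul_assoc, transpose_mul_projP, Matrix.zero_mul, sub_zero]

/-- These are the normal equations: preimages chosen by `pinv F.transpose - mOpt F Q₀` are
`Q₀⁻¹`-orthogonal to the kernel of `Fᵀ`, hence of least `Q₀⁻¹` norm. With `Q₀⁻¹ = CᵀC` and `Z =
(CP)ᵀ(CP)`, the range of `PCᵀ` equals that of `Z`, so the projector `Z Z⁺` fixes `P Q₀⁻¹`. -/
theorem projP_mul_inv_mul_pinv_sub_mOpt (hQ₀ : Q₀.PosDef) :
    projP F * Q₀⁻¹ * (pinv F.transpose - mOpt F Q₀) = 0 := by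
  obtain ⟨C, -, hC⟩ := hQ₀.inv.exists_transpose_mul_self
  have hP := projP_transpose F
  set P := projP F
  set Z := P * Q₀⁻¹ * P with hZ
  have hZC : Z = (C * P).transpose * (C * P) := by
    rw [hZ, ← hC, Matrix.transpose_mul, hP]; simp only [Matrix.mul_assoc]
  have hZt : Z.transpose = Z := by rw [hZC]; simp [Matrix.transpose_mul]
  have hs := (pinv_spec Z).symm_left
  have h1 : Z * (Z * pinv Z) = Z := by
    have := congrArg Matrix.transpose (pinv_spec Z).mul_mul_left
    rwa [Matrix.transpose_mul, hs, hZt] at this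
  have h2 : C * P * (Z * pinv Z - 1) = 0 := by
    have : (C * P * (Z * pinv Z - 1)).transpose * (C * P * (Z * pinv Z - 1)) = 0 := by
      rw [Matrix.transpose_mul (C * P), Matrix.mul_assoc, ← Matrix.mul_assoc (C * P).transpose,
        ← hZC, Matrix.mul_sub, h1, Matrix.mul_one, sub_self, Matrix.mul_zero]
    rw [← Matrix.conjTranspose_eq_transpose_of_trivial] at this
    exact Matrix.conjTranspose_mul_self_eq_zero.mp this
  have h3 : Z * pinv Z * P * C.transpose = P * C.transpose := by
    have := congrArg Matrix.transpose h2
    rw [Matrix.transpose_mul, Matrix.transpose_sub, hs, Matrix.transpose_mul, hP,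
      Matrix.transpose_one, Matrix.transpose_zero, sub_mul, one_mul, sub_eq_zero] at this
    rw [Matrix.mul_assoc]; exact this
  have h4 : Z * pinv Z * P * Q₀⁻¹ = P * Q₀⁻¹ := by
    rw [← hC, ← Matrix.mul_assoc, h3, Matrix.mul_assoc]
  rw [Matrix.mul_sub, sub_eq_zero]
  calc P * Q₀⁻¹ * pinv F.transpose = Z * pinv Z * P * Q₀⁻¹ * pinv F.transpose := by rw [h4]
    _ = _ := by
      rw [mOpt]
      change P * Q₀⁻¹ * P * pinv Z * P * Q₀⁻¹ * pinv F.transpose =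
        P * Q₀⁻¹ * (P * pinv Z * P * Q₀⁻¹ * pinv F.transpose)
      simp only [Matrix.mul_assoc]

/-- The value of `barQ₀` at `q` is attained by a vector with the same image under `Fᵀ`. -/
theorem dotProduct_barQ₀_mulVec (Q₀ : Matrix (Fin m) (Fin m) ℝ) (q : Fin m → ℝ) :
    (pinv F.transpose - mOpt F Q₀).mulVec (F.transpose.mulVec q) ⬝ᵥ
      Q₀⁻¹.mulVec ((pinv F.transpose - mOpt F Q₀).mulVec (F.transpose.mulVec q)) =
      q ⬝ᵥ (barQ₀ F Q₀).mulVec q := by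
  rw [barQ₀]
  set N := pinv F.transpose - mOpt F Q₀
  simp only [← Matrix.mulVec_mulVec]
  rw [← transpose_mulVec_dotProduct F, ← transpose_mulVec_dotProduct N.transpose,
    Matrix.transpose_transpose]

theorem transpose_mulVec_pinv_sub_mOpt (q : Fin m → ℝ) :
    F.transpose.mulVec ((pinv F.transpose - mOpt F Q₀).mulVec (F.transpose.mulVec q)) =
      F.transpose.mulVec q := by
  rw [Matrix.mulVec_mulVec, Matrix.mulVec_mulVec, transpose_mul_pinv_sub_mOpt]

/-- The quadratic form of `barQ₀` is the minimum of that of `Q₀⁻¹` over a fibre of `Fᵀ`. -/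
theorem barQ₀_le (hQ₀ : Q₀.PosDef) {q w : Fin m → ℝ}
    (h : F.transpose.mulVec w = F.transpose.mulVec q) :
    q ⬝ᵥ (barQ₀ F Q₀).mulVec q ≤ w ⬝ᵥ Q₀⁻¹.mulVec w := by
  rw [← dotProduct_barQ₀_mulVec]
  have hw := transpose_mulVec_pinv_sub_mOpt F (Q₀ := Q₀) q
  have h0 := projP_mul_inv_mul_pinv_sub_mOpt F hQ₀
  set N := pinv F.transpose - mOpt F Q₀
  set a := N.mulVec (F.transpose.mulVec q) with ha
  -- Pythagoras: `v` lies in the kernel of `Fᵀ`, and the cross terms vanish by the normal equations.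
  obtain ⟨v, rfl⟩ : ∃ v, w = a + v := ⟨w - a, by abel⟩
  have hv : F.transpose.mulVec v = 0 := by
    rw [Matrix.mulVec_add, hw] at h
    simpa using h
  have hPv : (projP F).mulVec v = v := by
    rw [projP, Matrix.sub_mulVec, Matrix.one_mulVec, ← Matrix.mulVec_mulVec, hv,
      Matrix.mulVec_zero, sub_zero]
  have hva : v ⬝ᵥ Q₀⁻¹.mulVec a = 0 := by
    rw [← hPv, ← projP_transpose, transpose_mulVec_dotProduct, Matrix.mulVec_mulVec, ha,
      Matrix.mulVec_mulVec, h0, Matrix.zero_mulVec, dotProduct_zero]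
  have hav : a ⬝ᵥ Q₀⁻¹.mulVec v = 0 := by
    have hs : Q₀⁻¹.transpose = Q₀⁻¹ := by
      rw [← Matrix.conjTranspose_eq_transpose_of_trivial]; exact hQ₀.inv.1
    rw [← transpose_mulVec_dotProduct, hs, dotProduct_comm, hva]
  have hvv : 0 ≤ v ⬝ᵥ Q₀⁻¹.mulVec v := hQ₀.inv.posSemidef.dotProduct_mulVec_nonneg v
  rw [Matrix.mulVec_add, add_dotProduct, dotProduct_add, dotProduct_add, hva, hav]
  linarith

end Weights

/-! ### Riesz representation and least-norm points -/

section Hilbert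

variable {E : Type*} [NormedAddCommGroup E] [InnerProductSpace ℝ E] [CompleteSpace E]

/-- Riesz representation of a bounded functional given by its graph over a subspace. -/
theorem exists_inner_eq_of_graph_bound (Γ : Submodule ℝ (E × ℝ)) {c : ℝ} (hc : 0 ≤ c)
    (h : ∀ z ∈ Γ, z.2 ^ 2 ≤ c * ‖z.1‖ ^ 2) :
    ∃ a : E, ‖a‖ ^ 2 ≤ c ∧ ∀ z ∈ Γ, inner ℝ a z.1 = z.2 := by
  -- The bound makes the relation single valued, so `Γ` is the graph of a partial linear map. A
  -- Hahn-Banach extension of the same norm then avoids any closedness of its domain.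
  have h0 : ∀ z ∈ Γ, z.1 = 0 → z.2 = 0 := by
    intro z hz h1
    have := h z hz
    rw [h1, norm_zero] at this
    have : z.2 ^ 2 = 0 := le_antisymm (by simpa using this) (sq_nonneg _)
    exact pow_eq_zero_iff (two_ne_zero) |>.1 this
  have hmem := fun x => Submodule.mem_graph_toLinearPMap (g := Γ) h0 x
  let L := Γ.toLinearPMap.toFun
  have hb : ∀ x : Γ.toLinearPMap.domain, ‖L x‖ ≤ Real.sqrt c * ‖x‖ := by
    intro x
    have := Real.abs_le_sqrt (h _ (hmem x))
    rwa [Real.sqrt_mul hc, Real.sqrt_sq (norm_nonneg _)] at this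
  obtain ⟨g, hg, hn⟩ := exists_extension_norm_eq Γ.toLinearPMap.domain (L.mkContinuous _ hb)
  refine ⟨(InnerProductSpace.toDual ℝ E).symm g, ?_, fun z hz => ?_⟩
  · rw [LinearIsometryEquiv.norm_map, hn]
    calc _ ≤ Real.sqrt c ^ 2 := by
          gcongr
          exact L.mkContinuous_norm_le (Real.sqrt_nonneg _) hb
      _ = c := Real.sq_sqrt hc
  · rw [InnerProductSpace.toDual_symm_apply]
    have hd : z.1 ∈ Γ.toLinearPMap.domain := ⟨z, hz, rfl⟩
    have h2 := hg ⟨z.1, hd⟩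
    simp only at h2
    rw [h2]
    have h3 := Γ.sub_mem (hmem ⟨z.1, hd⟩) hz
    have h4 := h0 _ h3 (by simp)
    exact sub_eq_zero.1 h4

/-- The constraints define a nonempty intersection of closed affine sets, onto which `0` can be
projected. -/
theorem exists_norm_min_of_inner_eq (S : Set (E × ℝ)) {a₀ : E}
    (h₀ : ∀ s ∈ S, inner ℝ a₀ s.1 = s.2) :
    ∃ a : E, (∀ s ∈ S, inner ℝ a s.1 = s.2) ∧
      ∀ b : E, (∀ s ∈ S, inner ℝ b s.1 = s.2) → ‖a‖ ≤ ‖b‖ := by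
  let K : Set E := {a | ∀ s ∈ S, inner ℝ a s.1 = s.2}
  have hK : IsClosed K := by
    have : K = ⋂ s ∈ S, {a | inner ℝ a s.1 = s.2} := by ext; simp [K]
    rw [this]
    exact isClosed_biInter fun s _ => isClosed_eq (by fun_prop) continuous_const
  have hconv : Convex ℝ K := by
    intro a ha b hb α β _ _ hαβ s hs
    rw [inner_add_left, real_inner_smul_left, real_inner_smul_left, ha s hs, hb s hs, ← add_mul,
      hαβ, one_mul]
  obtain ⟨a, ha, hmin⟩ := exists_norm_eq_iInf_of_complete_convex (K := K) ⟨a₀, h₀⟩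
    hK.isComplete hconv 0
  refine ⟨a, ha, fun b hb => ?_⟩
  rw [zero_sub, norm_neg] at hmin
  rw [hmin]
  have := ciInf_le (f := fun w : K => ‖0 - (w : E)‖) ⟨0, by rintro _ ⟨w, rfl⟩; positivity⟩ ⟨b, hb⟩
  simpa using this

end Hilbert

/-! ### The weighted Hilbert space of data -/

section DataSpace

/-- The Hilbert space `L²([0, T], ℝᵏ)`. -/
abbrev L2Space (k : ℕ) (T : ℝ) : Type :=
  Lp (EuclideanSpace ℝ (Fin k)) 2 (volume.restrict (Set.Icc 0 T))

/-- The Hilbert space `ℝᵐ × L²([0, T], ℝᵐ) × L²([0, T], ℝᵖ)`. -/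
abbrev DataSpace (m p : ℕ) (T : ℝ) : Type :=
  WithLp 2 (EuclideanSpace ℝ (Fin m) × WithLp 2 (L2Space m T × L2Space p T))

variable {m p k : ℕ} {T : ℝ}

theorem IsL2.memLp_toLp {v : ℝ → Fin k → ℝ} (hv : IsL2 T v) :
    MemLp (fun t => (WithLp.toLp 2 (v t) : EuclideanSpace ℝ (Fin k))) 2
      (volume.restrict (Set.Icc 0 T)) :=
  MemLp.of_eval_piLp fun i => MemLp.eval hv i

/-- The element of `L²` represented by a square integrable function. -/
noncomputable def IsL2.toL2 {v : ℝ → Fin k → ℝ} (hv : IsL2 T v) : L2Space k T :=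
  hv.memLp_toLp.toLp _

theorem IsL2.inner_toL2 (hT : 0 ≤ T) {v w : ℝ → Fin k → ℝ} (hv : IsL2 T v) (hw : IsL2 T w) :
    inner ℝ hv.toL2 hw.toL2 = ∫ t in (0 : ℝ)..T, v t ⬝ᵥ w t := by
  rw [L2.inner_def, intervalIntegral.integral_of_le hT, ← integral_Icc_eq_integral_Ioc]
  refine integral_congr_ae ?_
  filter_upwards [hv.memLp_toLp.coeFn_toLp, hw.memLp_toLp.coeFn_toLp] with t h1 h2
  rw [IsL2.toL2, IsL2.toL2, h1, h2, EuclideanSpace.inner_toLp_toLp, star_trivial, dotProduct_comm]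

theorem exists_toL2_eq (ξ : L2Space k T) : ∃ (v : ℝ → Fin k → ℝ) (hv : IsL2 T v), hv.toL2 = ξ := by
  have h : IsL2 T fun t => WithLp.ofLp (ξ t) := MemLp.of_eval fun i => (Lp.memLp ξ).eval_piLp i
  exact ⟨_, h, Lp.toLp_coeFn ξ (Lp.memLp ξ)⟩

/-- The point of the data space with components `M₀ g₀`, `M₁ g`, `M₂ h`. -/
noncomputable def weightedPoint (M₀ M₁ : Matrix (Fin m) (Fin m) ℝ) (M₂ : Matrix (Fin p) (Fin p) ℝ)
    (g₀ : Fin m → ℝ) {g : ℝ → Fin m → ℝ} {h : ℝ → Fin p → ℝ} (hg : IsL2 T g) (hh : IsL2 T h) :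
    DataSpace m p T :=
  WithLp.toLp 2 (WithLp.toLp 2 (M₀.mulVec g₀),
    WithLp.toLp 2 ((hg.mulVec M₁).toL2, (hh.mulVec M₂).toL2))

theorem dotProduct_mulVec_mulVec {k l : ℕ} (C B : Matrix (Fin l) (Fin k) ℝ) (a g : Fin k → ℝ) :
    C.mulVec a ⬝ᵥ B.mulVec g = a ⬝ᵥ (C.transpose * B).mulVec g := by
  rw [← Matrix.mulVec_mulVec, dotProduct_comm a, transpose_mulVec_dotProduct, dotProduct_comm]

variable {g₀ a₀ : Fin m → ℝ} {g a : ℝ → Fin m → ℝ} {h b : ℝ → Fin p → ℝ}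

theorem inner_weightedPoint (hT : 0 ≤ T) (C₀ C₁ B₀ B₁ : Matrix (Fin m) (Fin m) ℝ)
    (C₂ B₂ : Matrix (Fin p) (Fin p) ℝ) (ha : IsL2 T a) (hb : IsL2 T b) (hg : IsL2 T g)
    (hh : IsL2 T h) :
    inner ℝ (weightedPoint C₀ C₁ C₂ a₀ ha hb) (weightedPoint B₀ B₁ B₂ g₀ hg hh) =
      a₀ ⬝ᵥ (C₀.transpose * B₀).mulVec g₀ + ∫ t in (0 : ℝ)..T,
        (a t ⬝ᵥ (C₁.transpose * B₁).mulVec (g t) + b t ⬝ᵥ (C₂.transpose * B₂).mulVec (h t)) := by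
  rw [weightedPoint, weightedPoint, WithLp.prod_inner_apply, WithLp.prod_inner_apply,
    intervalIntegral.integral_add]
  · simp only [IsL2.inner_toL2 hT, EuclideanSpace.inner_toLp_toLp, star_trivial]
    rw [dotProduct_comm (B₀.mulVec g₀)]
    simp only [dotProduct_mulVec_mulVec]
  · exact ha.intervalIntegrable_dotProduct hT (hg.mulVec _)
  · exact hb.intervalIntegrable_dotProduct hT (hh.mulVec _)

theorem norm_sq_weightedPoint (hT : 0 ≤ T) (B₀ B₁ : Matrix (Fin m) (Fin m) ℝ)
    (B₂ : Matrix (Fin p) (Fin p) ℝ) (hg : IsL2 T g) (hh : IsL2 T h) :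
    ‖weightedPoint B₀ B₁ B₂ g₀ hg hh‖ ^ 2 =
      rho g₀ g h T (B₀.transpose * B₀) (B₁.transpose * B₁) (B₂.transpose * B₂) := by
  rw [← real_inner_self_eq_norm_sq, inner_weightedPoint hT, rho]

theorem exists_weightedPoint_eq {C₀ C₁ B₀ B₁ : Matrix (Fin m) (Fin m) ℝ}
    {C₂ B₂ : Matrix (Fin p) (Fin p) ℝ} (h₀ : C₀ * B₀ = 1) (h₁ : C₁ * B₁ = 1) (h₂ : C₂ * B₂ = 1)
    (ξ : DataSpace m p T) :
    ∃ (a₀ : Fin m → ℝ) (a : ℝ → Fin m → ℝ) (b : ℝ → Fin p → ℝ) (ha : IsL2 T a) (hb : IsL2 T b),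
      weightedPoint C₀ C₁ C₂ a₀ ha hb = ξ := by
  obtain ⟨v, hv, hv'⟩ := exists_toL2_eq ξ.snd.fst
  obtain ⟨w, hw, hw'⟩ := exists_toL2_eq ξ.snd.snd
  refine ⟨B₀.mulVec (WithLp.ofLp ξ.fst), _, _, hv.mulVec B₁, hw.mulVec B₂, ?_⟩
  simp only [weightedPoint, Matrix.mulVec_mulVec, h₀, h₁, h₂, Matrix.one_mulVec, hv', hw']
  rfl

theorem weightedPoint_add (B₀ B₁ : Matrix (Fin m) (Fin m) ℝ) (B₂ : Matrix (Fin p) (Fin p) ℝ)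
    (ha : IsL2 T a) (hb : IsL2 T b) (hg : IsL2 T g) (hh : IsL2 T h) :
    weightedPoint B₀ B₁ B₂ (a₀ + g₀) (ha.add hg) (hb.add hh) =
      weightedPoint B₀ B₁ B₂ a₀ ha hb + weightedPoint B₀ B₁ B₂ g₀ hg hh := by
  simp only [weightedPoint, ← WithLp.toLp_add, Prod.mk_add_mk, IsL2.toL2, ← MemLp.toLp_add,
    Matrix.mulVec_add]
  rfl

theorem weightedPoint_smul (B₀ B₁ : Matrix (Fin m) (Fin m) ℝ) (B₂ : Matrix (Fin p) (Fin p) ℝ)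
    (c : ℝ) (hg : IsL2 T g) (hh : IsL2 T h) :
    weightedPoint B₀ B₁ B₂ (c • g₀) (hg.smul c) (hh.smul c) =
      c • weightedPoint B₀ B₁ B₂ g₀ hg hh := by
  simp only [weightedPoint, ← WithLp.toLp_smul, Prod.smul_mk, IsL2.toL2, ← MemLp.toLp_const_smul,
    Matrix.mulVec_smul]
  rfl

/-- The bilinear pairing `a₀ᵀg₀ + ∫₀ᵀ (aᵀg + bᵀh) dt`. -/
noncomputable def pairing (T : ℝ) (a₀ : Fin m → ℝ) (a : ℝ → Fin m → ℝ) (b : ℝ → Fin p → ℝ)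
    (g₀ : Fin m → ℝ) (g : ℝ → Fin m → ℝ) (h : ℝ → Fin p → ℝ) : ℝ :=
  a₀ ⬝ᵥ g₀ + ∫ t in (0 : ℝ)..T, (a t ⬝ᵥ g t + b t ⬝ᵥ h t)

/-- Taking `C` as the inverse transpose of `B` gives `(Ca)ᵀ(Bg) = aᵀg`: primal data scaled by `B`
and dual data scaled by `C` meet in the unweighted pairing, while their norms carry `Q` and `Q⁻¹`.
-/
theorem _root_.Matrix.PosDef.exists_dual_factors {k : ℕ} {Q : Matrix (Fin k) (Fin k) ℝ}
    (hQ : Q.PosDef) : ∃ B C : Matrix (Fin k) (Fin k) ℝ, B.transpose * B = Q ∧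
      C.transpose * C = Q⁻¹ ∧ C.transpose * B = 1 ∧ C * B.transpose = 1 := by
  obtain ⟨B, hB, rfl⟩ := hQ.exists_transpose_mul_self
  have hd : IsUnit B.det := (Matrix.isUnit_iff_isUnit_det B).1 hB
  refine ⟨B, B.transpose⁻¹, rfl, ?_, ?_, ?_⟩
  · rw [Matrix.mul_inv_rev, Matrix.transpose_nonsing_inv, Matrix.transpose_transpose]
  · rw [Matrix.transpose_nonsing_inv, Matrix.transpose_transpose, Matrix.nonsing_inv_mul _ hd]
  · exact Matrix.nonsing_inv_mul _ (by rwa [Matrix.det_transpose])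

variable {Q₀ Q : Matrix (Fin m) (Fin m) ℝ} {R : Matrix (Fin p) (Fin p) ℝ}

theorem sq_pairing_le (hT : 0 ≤ T) (hQ₀ : Q₀.PosDef) (hQ : Q.PosDef) (hR : R.PosDef)
    (ha : IsL2 T a) (hb : IsL2 T b) (hg : IsL2 T g) (hh : IsL2 T h) :
    pairing T a₀ a b g₀ g h ^ 2 ≤ rho a₀ a b T Q₀⁻¹ Q⁻¹ R⁻¹ * rho g₀ g h T Q₀ Q R := by
  obtain ⟨B₀, C₀, e1, e2, e3, -⟩ := hQ₀.exists_dual_factors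
  obtain ⟨B₁, C₁, f1, f2, f3, -⟩ := hQ.exists_dual_factors
  obtain ⟨B₂, C₂, g1, g2, g3, -⟩ := hR.exists_dual_factors
  have hi := inner_weightedPoint (a₀ := a₀) (g₀ := g₀) hT C₀ C₁ B₀ B₁ C₂ B₂ ha hb hg hh
  simp only [e3, f3, g3, Matrix.one_mulVec] at hi
  rw [pairing, ← hi, ← e2, ← f2, ← g2, ← e1, ← f1, ← g1, ← norm_sq_weightedPoint hT _ _ _ ha hb,
    ← norm_sq_weightedPoint hT _ _ _ hg hh, ← mul_pow, ← sq_abs]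
  gcongr
  exact abs_real_inner_le_norm _ _

/-- Riesz representation in the data space, read back through the dual factors. -/
theorem exists_pairing_eq_of_bound (hT : 0 ≤ T) (hQ₀ : Q₀.PosDef) (hQ : Q.PosDef) (hR : R.PosDef)
    (Γ : Submodule ℝ ((Fin m → ℝ) × (ℝ → Fin m → ℝ) × (ℝ → Fin p → ℝ) × ℝ))
    (hΓ : ∀ z ∈ Γ, IsL2 T z.2.1 ∧ IsL2 T z.2.2.1) {c : ℝ} (hc : 0 ≤ c)
    (hb : ∀ z ∈ Γ, z.2.2.2 ^ 2 ≤ c * rho z.1 z.2.1 z.2.2.1 T Q₀ Q R) :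
    ∃ (a₀ : Fin m → ℝ) (a : ℝ → Fin m → ℝ) (b : ℝ → Fin p → ℝ), IsL2 T a ∧ IsL2 T b ∧
      rho a₀ a b T Q₀⁻¹ Q⁻¹ R⁻¹ ≤ c ∧
      ∀ z ∈ Γ, pairing T a₀ a b z.1 z.2.1 z.2.2.1 = z.2.2.2 := by
  obtain ⟨B₀, C₀, e1, e2, e3, e4⟩ := hQ₀.exists_dual_factors
  obtain ⟨B₁, C₁, f1, f2, f3, f4⟩ := hQ.exists_dual_factors
  obtain ⟨B₂, C₂, g1, g2, g3, g4⟩ := hR.exists_dual_factors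
  let L : Γ →ₗ[ℝ] DataSpace m p T × ℝ :=
    { toFun := fun z =>
        (weightedPoint B₀ B₁ B₂ z.1.1 (hΓ _ z.2).1 (hΓ _ z.2).2, z.1.2.2.2)
      map_add' := fun z z' => Prod.ext (weightedPoint_add B₀ B₁ B₂ (hΓ _ z.2).1 (hΓ _ z.2).2
        (hΓ _ z'.2).1 (hΓ _ z'.2).2) rfl
      map_smul' := fun r z => Prod.ext (weightedPoint_smul B₀ B₁ B₂ r (hΓ _ z.2).1
        (hΓ _ z.2).2) rfl }
  obtain ⟨ξ, hξ, hξΓ⟩ := exists_inner_eq_of_graph_bound (LinearMap.range L) hc (by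
    rintro _ ⟨z, rfl⟩
    change z.1.2.2.2 ^ 2 ≤ c * ‖weightedPoint B₀ B₁ B₂ z.1.1 (hΓ _ z.2).1 (hΓ _ z.2).2‖ ^ 2
    rw [norm_sq_weightedPoint hT, e1, f1, g1]
    exact hb _ z.2)
  obtain ⟨a₀, a, b, ha, hb, rfl⟩ := exists_weightedPoint_eq e4 f4 g4 ξ
  refine ⟨a₀, a, b, ha, hb, ?_, fun z hz => ?_⟩
  · rwa [norm_sq_weightedPoint hT, e2, f2, g2] at hξ
  · have h1 : inner ℝ (weightedPoint C₀ C₁ C₂ a₀ ha hb)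
        (weightedPoint B₀ B₁ B₂ z.1 (hΓ _ hz).1 (hΓ _ hz).2) = z.2.2.2 := hξΓ _ ⟨⟨z, hz⟩, rfl⟩
    rw [inner_weightedPoint hT, e3, f3, g3] at h1
    simpa only [pairing, Matrix.one_mulVec] using h1

theorem exists_min_rho_of_pairing_eq (hT : 0 ≤ T) (hQ₀ : Q₀.PosDef) (hQ : Q.PosDef) (hR : R.PosDef)
    (S : Set ((Fin m → ℝ) × (ℝ → Fin m → ℝ) × (ℝ → Fin p → ℝ) × ℝ))
    (hS : ∀ z ∈ S, IsL2 T z.2.1 ∧ IsL2 T z.2.2.1) (ha : IsL2 T a) (hb : IsL2 T b)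
    (hab : ∀ z ∈ S, pairing T a₀ a b z.1 z.2.1 z.2.2.1 = z.2.2.2) :
    ∃ (w₀ : Fin m → ℝ) (w : ℝ → Fin m → ℝ) (v : ℝ → Fin p → ℝ), IsL2 T w ∧ IsL2 T v ∧
      (∀ z ∈ S, pairing T w₀ w v z.1 z.2.1 z.2.2.1 = z.2.2.2) ∧
      ∀ (a₀ : Fin m → ℝ) (a : ℝ → Fin m → ℝ) (b : ℝ → Fin p → ℝ), IsL2 T a → IsL2 T b →
        (∀ z ∈ S, pairing T a₀ a b z.1 z.2.1 z.2.2.1 = z.2.2.2) →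
        rho w₀ w v T Q₀⁻¹ Q⁻¹ R⁻¹ ≤ rho a₀ a b T Q₀⁻¹ Q⁻¹ R⁻¹ := by
  obtain ⟨B₀, C₀, e1, e2, e3, e4⟩ := hQ₀.exists_dual_factors
  obtain ⟨B₁, C₁, f1, f2, f3, f4⟩ := hQ.exists_dual_factors
  obtain ⟨B₂, C₂, g1, g2, g3, g4⟩ := hR.exists_dual_factors
  have hi : ∀ {a₀ g₀ : Fin m → ℝ} {a g : ℝ → Fin m → ℝ} {b h : ℝ → Fin p → ℝ} (ha : IsL2 T a)
      (hb : IsL2 T b) (hg : IsL2 T g) (hh : IsL2 T h),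
      inner ℝ (weightedPoint C₀ C₁ C₂ a₀ ha hb) (weightedPoint B₀ B₁ B₂ g₀ hg hh) =
        pairing T a₀ a b g₀ g h := by
    intro a₀ g₀ a g b h ha hb hg hh
    rw [inner_weightedPoint hT, e3, f3, g3]
    simp only [Matrix.one_mulVec, pairing]
  let S' : Set (DataSpace m p T × ℝ) := {s | ∃ z, ∃ hz : z ∈ S,
    s = (weightedPoint B₀ B₁ B₂ z.1 (hS z hz).1 (hS z hz).2, z.2.2.2)}
  have hfeas : ∀ {a₀ : Fin m → ℝ} {a : ℝ → Fin m → ℝ} {b : ℝ → Fin p → ℝ} (ha : IsL2 T a)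
      (hb : IsL2 T b), (∀ s ∈ S', inner ℝ (weightedPoint C₀ C₁ C₂ a₀ ha hb) s.1 = s.2) ↔
      ∀ z ∈ S, pairing T a₀ a b z.1 z.2.1 z.2.2.1 = z.2.2.2 := by
    intro a₀ a b ha hb
    constructor
    · intro h z hz
      rw [← hi ha hb (hS z hz).1 (hS z hz).2]
      exact h _ ⟨z, hz, rfl⟩
    · rintro h _ ⟨z, hz, rfl⟩
      rw [hi, h z hz]
  obtain ⟨ξ, hξ, hmin⟩ := exists_norm_min_of_inner_eq S' ((hfeas ha hb).2 hab)
  obtain ⟨w₀, w, v, hw, hv, rfl⟩ := exists_weightedPoint_eq e4 f4 g4 ξ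
  refine ⟨w₀, w, v, hw, hv, (hfeas hw hv).1 hξ, fun a₀ a b ha hb hab => ?_⟩
  rw [← e2, ← f2, ← g2, ← norm_sq_weightedPoint hT _ _ _ hw hv,
    ← norm_sq_weightedPoint hT _ _ _ ha hb]
  gcongr
  exact hmin _ ((hfeas ha hb).2 hab)

end DataSpace

/-! ### The quadratic cost -/

section Quadratic

variable {m p : ℕ} {T : ℝ} {g₀ : Fin m → ℝ} {g g' : ℝ → Fin m → ℝ} {h h' : ℝ → Fin p → ℝ}
  {S₀ S₁ : Matrix (Fin m) (Fin m) ℝ} {S₂ : Matrix (Fin p) (Fin p) ℝ}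

theorem rho_integrand_nonneg (hS₁ : S₁.PosSemidef) (hS₂ : S₂.PosSemidef) (t : ℝ) :
    0 ≤ g t ⬝ᵥ S₁.mulVec (g t) + h t ⬝ᵥ S₂.mulVec (h t) :=
  add_nonneg (hS₁.dotProduct_mulVec_nonneg (g t)) (hS₂.dotProduct_mulVec_nonneg (h t))

theorem rho_nonneg (hT : 0 ≤ T) (hS₀ : S₀.PosSemidef) (hS₁ : S₁.PosSemidef)
    (hS₂ : S₂.PosSemidef) : 0 ≤ rho g₀ g h T S₀ S₁ S₂ :=
  add_nonneg (hS₀.dotProduct_mulVec_nonneg g₀)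
    (intervalIntegral.integral_nonneg hT fun t _ => rho_integrand_nonneg hS₁ hS₂ t)

/-- Reduces the bounds at all times in the definition of admissibility to the single bound at `T`.
-/
theorem rho_le_rho {t : ℝ} (ht : t ∈ Set.Icc 0 T) (hg : IsL2 T g) (hh : IsL2 T h)
    (hS₁ : S₁.PosSemidef) (hS₂ : S₂.PosSemidef) :
    rho g₀ g h t S₀ S₁ S₂ ≤ rho g₀ g h T S₀ S₁ S₂ := by
  have hT : 0 ≤ T := ht.1.trans ht.2
  refine add_le_add_right ?_ _
  exact intervalIntegral.integral_mono_interval le_rfl ht.1 ht.2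
    (Filter.Eventually.of_forall fun t => rho_integrand_nonneg hS₁ hS₂ t)
    ((hg.intervalIntegrable_dotProduct hT (hg.mulVec _)).add
      (hh.intervalIntegrable_dotProduct hT (hh.mulVec _)))

theorem rho_smul (c : ℝ) : rho (c • g₀) (fun t => c • g t) (fun t => c • h t) T S₀ S₁ S₂ =
    c ^ 2 * rho g₀ g h T S₀ S₁ S₂ := by
  simp only [rho, Matrix.mulVec_smul, smul_dotProduct, dotProduct_smul, smul_eq_mul, mul_add,
    ← intervalIntegral.integral_const_mul]
  congr 1
  · ring
  · congr 1; funext t; ring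

theorem rho_neg_right : rho g₀ g (fun t => -h t) T S₀ S₁ S₂ = rho g₀ g h T S₀ S₁ S₂ := by
  simp only [rho, Matrix.mulVec_neg, neg_dotProduct, dotProduct_neg, neg_neg]

theorem rho_reversal : rho g₀ (reversal T g) (reversal T h) T S₀ S₁ S₂ =
    rho g₀ g h T S₀ S₁ S₂ := by
  simp only [rho, reversal]
  rw [intervalIntegral.integral_comp_sub_left
    (fun t => g t ⬝ᵥ S₁.mulVec (g t) + h t ⬝ᵥ S₂.mulVec (h t)) T, sub_self, sub_zero]

theorem rho_congr (hT : 0 ≤ T) (hg : EqAE T g g') (hh : EqAE T h h') :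
    rho g₀ g h T S₀ S₁ S₂ = rho g₀ g' h' T S₀ S₁ S₂ := by
  rw [rho, rho]
  congr 1
  refine integral_congr_of_ae hT ?_
  filter_upwards [hg, hh] with t h1 h2
  rw [h1, h2]

end Quadratic

/-! ### Worst-case error and dual cost -/

section

variable {m n p : ℕ} {F A : Matrix (Fin m) (Fin n) ℝ} {H : Matrix (Fin p) (Fin n) ℝ} {T : ℝ}
  {Q₀ Q : Matrix (Fin m) (Fin m) ℝ} {R : Matrix (Fin p) (Fin p) ℝ} {ℓ : Fin m → ℝ}
  {x x' : ℝ → Fin n → ℝ} {f f' : ℝ → Fin m → ℝ} {y η y' η' U u : ℝ → Fin p → ℝ}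
  {q w : ℝ → Fin m → ℝ} {w₀ : Fin m → ℝ}

theorem IsSolution.isAdmissible (h : IsSolution F A H T x f y η) (hQ : Q.PosDef) (hR : R.PosDef)
    (hb : rho (F.mulVec (x 0)) f η T Q₀ Q R ≤ 1) : IsAdmissible F A H Q₀ Q R T x f y η :=
  ⟨h, fun _ ht => (rho_le_rho ht h.f_mem h.eta_mem hQ.posSemidef hR.posSemidef).trans hb⟩

theorem IsSolution.smul (hT : 0 ≤ T) (c : ℝ) (h : IsSolution F A H T x f y η) :
    IsSolution F A H T (fun t => c • x t) (fun t => c • f t) (fun t => c • y t)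
      (fun t => c • η t) := by
  have hst : ∀ t ∈ Set.Icc (0 : ℝ) T, F.mulVec (c • x t) = F.mulVec (c • x 0) +
      ∫ s in (0 : ℝ)..t, (A.mulVec (c • x s) + c • f s) := by
    intro t ht
    simp only [Matrix.mulVec_smul, ← smul_add]
    rw [intervalIntegral.integral_smul, ← smul_add, ← h.state_eq t ht]
  exact
    { x_mem := h.x_mem.smul c
      f_mem := h.f_mem.smul c
      y_mem := h.y_mem.smul c
      eta_mem := h.eta_mem.smul c
      abs_cont := absolutelyContinuousOnInterval_integral hT
        ((((h.x_mem.smul c).mulVec A).add (h.f_mem.smul c)).intervalIntegrable hT) _ hst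
      state_eq := hst
      output_eq := by
        filter_upwards [h.output_eq] with t ht
        rw [ht, smul_add, Matrix.mulVec_smul] }

theorem IsSolution.add (hT : 0 ≤ T) (h : IsSolution F A H T x f y η)
    (h' : IsSolution F A H T x' f' y' η') :
    IsSolution F A H T (fun t => x t + x' t) (fun t => f t + f' t) (fun t => y t + y' t)
      (fun t => η t + η' t) := by
  have hst : ∀ t ∈ Set.Icc (0 : ℝ) T, F.mulVec (x t + x' t) = F.mulVec (x 0 + x' 0) +
      ∫ s in (0 : ℝ)..t, (A.mulVec (x s + x' s) + (f s + f' s)) := by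
    intro t ht
    have hsub : Set.uIcc 0 t ⊆ Set.uIcc 0 T := by
      rw [Set.uIcc_of_le ht.1, Set.uIcc_of_le hT]
      exact Set.Icc_subset_Icc_right ht.2
    simp only [Matrix.mulVec_add, add_add_add_comm]
    rw [intervalIntegral.integral_add ((h.rhs_mem.intervalIntegrable hT).mono_set hsub)
      ((h'.rhs_mem.intervalIntegrable hT).mono_set hsub), h.state_eq t ht, h'.state_eq t ht]
    abel
  exact
    { x_mem := h.x_mem.add h'.x_mem
      f_mem := h.f_mem.add h'.f_mem
      y_mem := h.y_mem.add h'.y_mem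
      eta_mem := h.eta_mem.add h'.eta_mem
      abs_cont := absolutelyContinuousOnInterval_integral hT
        ((((h.x_mem.add h'.x_mem).mulVec A).add (h.f_mem.add h'.f_mem)).intervalIntegrable hT) _ hst
      state_eq := hst
      output_eq := by
        filter_upwards [h.output_eq, h'.output_eq] with t ht ht'
        rw [ht, ht', Matrix.mulVec_add]
        abel }

/-- A test solution whose output is pure noise: it isolates the noise component of a representing
vector. -/
theorem isSolution_noise (hη : IsL2 T η) :
    IsSolution F A H T (fun _ => 0) (fun _ => 0) η η where
  x_mem := IsL2.zero
  f_mem := IsL2.zero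
  y_mem := hη
  eta_mem := hη
  abs_cont := by
    rw [absolutelyContinuousOnInterval_iff]
    intro ε hε
    exact ⟨1, one_pos, fun E _ _ => by simpa using hε⟩
  state_eq := by simp
  output_eq := by simp [EqAE]

theorem estimate_add (hT : 0 ≤ T) (hU : IsL2 T U) (hy : IsL2 T y) (hy' : IsL2 T y') :
    estimate T U (fun t => y t + y' t) = estimate T U y + estimate T U y' := by
  simp only [estimate, add_dotProduct]
  exact intervalIntegral.integral_add (hy.intervalIntegrable_dotProduct hT hU)
    (hy'.intervalIntegrable_dotProduct hT hU)

theorem estimate_smul (c : ℝ) : estimate T U (fun t => c • y t) = c * estimate T U y := by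
  simp only [estimate, smul_dotProduct, smul_eq_mul, intervalIntegral.integral_const_mul]

/-- The data `(Fx(0), f, η)` of the primal solutions with the resulting estimation errors. -/
noncomputable def errorGraph (F A : Matrix (Fin m) (Fin n) ℝ) (H : Matrix (Fin p) (Fin n) ℝ)
    (ℓ : Fin m → ℝ) (hT : 0 ≤ T) (hU : IsL2 T U) :
    Submodule ℝ ((Fin m → ℝ) × (ℝ → Fin m → ℝ) × (ℝ → Fin p → ℝ) × ℝ) where
  carrier := {z | ∃ x f y η, IsSolution F A H T x f y η ∧
    z = (F.mulVec (x 0), f, η, ℓ ⬝ᵥ F.mulVec (x T) - estimate T U y)}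
  add_mem' := by
    rintro _ _ ⟨x, f, y, η, h, rfl⟩ ⟨x', f', y', η', h', rfl⟩
    refine ⟨_, _, _, _, h.add hT h', ?_⟩
    rw [estimate_add hT hU h.y_mem h'.y_mem, Matrix.mulVec_add, Matrix.mulVec_add, dotProduct_add,
      add_sub_add_comm]
    rfl
  zero_mem' := ⟨_, _, _, _, isSolution_noise IsL2.zero, by
    simp only [estimate, zero_dotProduct, Matrix.mulVec_zero, dotProduct_zero,
      intervalIntegral.integral_zero, sub_zero]
    rfl⟩
  smul_mem' := by
    rintro c _ ⟨x, f, y, η, h, rfl⟩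
    refine ⟨_, _, _, _, h.smul hT c, ?_⟩
    rw [estimate_smul, Matrix.mulVec_smul, Matrix.mulVec_smul, dotProduct_smul, smul_eq_mul,
      ← mul_sub]
    rfl

theorem sq_error_le_dualCost (hT : 0 ≤ T) (hQ₀ : Q₀.PosDef) (hQ : Q.PosDef) (hR : R.PosDef)
    (hq : (q, u) ∈ dualSetWithInput F A H ℓ T U) (h : IsAdmissible F A H Q₀ Q R T x f y η) :
    (ℓ ⬝ᵥ F.mulVec (x T) - estimate T U y) ^ 2 ≤ dualCost F Q₀ Q R T q u := by
  obtain ⟨⟨hq, hq0⟩, hu⟩ := hq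
  simp only at hq hq0 hu
  have hs := h.solution
  have hU : EqAE T U (reversal T u) := by
    simpa only [reversal_reversal] using hu.reversal.symm
  have hd := hq.duality hT hs
  -- The cheapest vector with the same image under `Fᵀ` as `q(T)`. Replacing `q(T)` by it leaves the
  -- pairing unchanged and turns the `Q₀⁻¹` cost into the `barQ₀` cost.
  set a₀ := (pinv F.transpose - mOpt F Q₀).mulVec (F.transpose.mulVec (q T)) with ha₀
  have hFa : F.transpose.mulVec a₀ = F.transpose.mulVec (q T) :=
    transpose_mulVec_pinv_sub_mOpt F (q T)
  have hqr := hq.q_mem.reversal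
  have hur := hq.u_mem.reversal
  have herr : ℓ ⬝ᵥ F.mulVec (x T) - estimate T U y =
      pairing T a₀ (reversal T q) (fun t => -reversal T u t) (F.mulVec (x 0)) f η := by
    have e : estimate T U y = ∫ t in (0 : ℝ)..T,
        (reversal T u t ⬝ᵥ H.mulVec (x t) + reversal T u t ⬝ᵥ η t) := by
      refine integral_congr_of_ae hT ?_
      filter_upwards [hU, hs.output_eq] with t h1 h2
      rw [h1, h2, add_dotProduct, dotProduct_comm, dotProduct_comm (η t)]
    rw [hq0, transpose_mulVec_dotProduct, ← hFa, transpose_mulVec_dotProduct,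
      intervalIntegral.integral_add (hqr.intervalIntegrable_dotProduct hT hs.f_mem)
        (hur.intervalIntegrable_dotProduct hT (hs.x_mem.mulVec H))] at hd
    rw [intervalIntegral.integral_add (hur.intervalIntegrable_dotProduct hT (hs.x_mem.mulVec H))
      (hur.intervalIntegrable_dotProduct hT hs.eta_mem)] at e
    rw [e, pairing, intervalIntegral.integral_add (hqr.intervalIntegrable_dotProduct hT hs.f_mem)
      (hur.neg.intervalIntegrable_dotProduct hT hs.eta_mem)]
    simp only [neg_dotProduct, intervalIntegral.integral_neg]
    linarith
  have hcost : rho a₀ (reversal T q) (fun t => -reversal T u t) T Q₀⁻¹ Q⁻¹ R⁻¹ =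
      dualCost F Q₀ Q R T q u := by
    rw [rho_neg_right, rho_reversal, dualCost, rho, rho, ha₀, dotProduct_barQ₀_mulVec]
  rw [herr, ← hcost]
  refine (sq_pairing_le hT hQ₀ hQ hR hqr hur.neg hs.f_mem hs.eta_mem).trans ?_
  exact mul_le_of_le_one_right
    (rho_nonneg hT hQ₀.inv.posSemidef hQ.inv.posSemidef hR.inv.posSemidef)
    (h.bound T ⟨hT, le_rfl⟩)

theorem dualCost_le_rho (hT : 0 ≤ T) (hQ₀ : Q₀.PosDef) (hqw : EqAE T q (reversal T w))
    (h0 : F.transpose.mulVec (q T) = F.transpose.mulVec w₀) :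
    dualCost F Q₀ Q R T q (reversal T U) ≤ rho w₀ w U T Q₀⁻¹ Q⁻¹ R⁻¹ := by
  rw [dualCost, rho_congr hT hqw (Filter.EventuallyEq.refl _ _), rho_reversal, rho, rho]
  exact add_le_add_left (barQ₀_le F hQ₀ h0.symm) _

/-- By homogeneity: a solution of cost `r` is scaled by `1/√s` to be admissible. Taking `s > r` and
letting `s` decrease to `r` includes the case `r = 0`, where no normalization exists. -/
theorem sq_le_mul_rho_of_worstCaseError_le (hT : 0 ≤ T) (hQ₀ : Q₀.PosDef) (hQ : Q.PosDef)
    (hR : R.PosDef) {c : ℝ} (hσ : worstCaseError F A H Q₀ Q R ℓ T U ≤ (c : EReal))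
    (h : IsSolution F A H T x f y η) :
    (ℓ ⬝ᵥ F.mulVec (x T) - estimate T U y) ^ 2 ≤ c * rho (F.mulVec (x 0)) f η T Q₀ Q R := by
  set r := rho (F.mulVec (x 0)) f η T Q₀ Q R with hr
  have hr0 : 0 ≤ r := rho_nonneg hT hQ₀.posSemidef hQ.posSemidef hR.posSemidef
  have key : ∀ s : ℝ, r < s →
      (ℓ ⬝ᵥ F.mulVec (x T) - estimate T U y) ^ 2 ≤ c * s := by
    intro s hs
    have hs0 : 0 < s := hr0.trans_lt hs
    have ha := (h.smul hT (Real.sqrt s)⁻¹).isAdmissible (Q₀ := Q₀) hQ hR (by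
      rw [Matrix.mulVec_smul, rho_smul, ← hr, inv_pow, Real.sq_sqrt hs0.le]
      exact inv_mul_le_one_of_le₀ hs.le hs0.le)
    have := (le_sSup ⟨_, _, _, _, ha, rfl⟩ : _ ≤ worstCaseError F A H Q₀ Q R ℓ T U).trans hσ
    rw [EReal.coe_le_coe_iff, estimate_smul, Matrix.mulVec_smul, dotProduct_smul, smul_eq_mul,
      ← mul_sub, mul_pow, inv_pow, Real.sq_sqrt hs0.le, inv_mul_le_iff₀ hs0, mul_comm s] at this
    exact this
  have hlim : Filter.Tendsto (fun s => c * s) (nhdsWithin r (Set.Ioi r)) (nhds (c * r)) :=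
    ((continuous_const.mul continuous_id).tendsto r).mono_left nhdsWithin_le_nhds
  exact ge_of_tendsto hlim (eventually_mem_nhdsWithin.mono key)

theorem exists_dualCost_le_of_worstCaseError_le (hT : 0 < T) (hQ₀ : Q₀.PosDef) (hQ : Q.PosDef)
    (hR : R.PosDef) (hU : IsL2 T U) {c : ℝ}
    (hσ : worstCaseError F A H Q₀ Q R ℓ T U ≤ (c : EReal)) (hc : 0 ≤ c) :
    ∃ q, (q, reversal T U) ∈ dualSetWithInput F A H ℓ T U ∧
      dualCost F Q₀ Q R T q (reversal T U) ≤ c := by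
  obtain ⟨w₀, w, b, hw, hb, hcost, hpair⟩ := exists_pairing_eq_of_bound hT.le hQ₀ hQ hR
    (errorGraph F A H ℓ hT.le hU)
    (by rintro _ ⟨x, f, y, η, h, rfl⟩; exact ⟨h.f_mem, h.eta_mem⟩) hc
    (by
      rintro _ ⟨x, f, y, η, h, rfl⟩
      exact sq_le_mul_rho_of_worstCaseError_le hT.le hQ₀ hQ hR hσ h)
  have hpair' : ∀ {x f y η}, IsSolution F A H T x f y η →
      pairing T w₀ w b (F.mulVec (x 0)) f η = ℓ ⬝ᵥ F.mulVec (x T) - estimate T U y :=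
    fun {x f y η} h => hpair _ ⟨x, f, y, η, h, rfl⟩
  -- Testing with the noise `b + U` gives `∫ bᵀ(b + U) = -∫ (b + U)ᵀU`, that is, `∫ |b + U|² = 0`.
  have hbU : EqAE T b (fun t => -U t) := by
    have hz := hpair' (isSolution_noise (F := F) (A := A) (H := H) (hb.add hU))
    simp only [pairing, Matrix.mulVec_zero, dotProduct_zero, zero_add, estimate, zero_sub] at hz
    have hz' : ∫ t in (0 : ℝ)..T, (b t + U t) ⬝ᵥ (b t + U t) = 0 := by
      refine Eq.trans ?_ (sub_eq_zero_of_eq hz)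
      rw [sub_neg_eq_add, ← intervalIntegral.integral_add
        (hb.intervalIntegrable_dotProduct hT.le (hb.add hU))
        ((hb.add hU).intervalIntegrable_dotProduct hT.le hU)]
      simp only [dotProduct_comm (b _ + U _) (U _), ← add_dotProduct]
    rw [intervalIntegral.integral_of_le hT.le, ← integral_Icc_eq_integral_Ioc,
      integral_eq_zero_iff_of_nonneg] at hz'
    · filter_upwards [hz'] with t ht
      exact eq_neg_of_add_eq_zero_left (dotProduct_self_eq_zero.1 ht)
    · exact fun t => Finset.sum_nonneg fun i _ => mul_self_nonneg _
    · exact (intervalIntegrable_iff_integrableOn_Icc_of_le hT.le).1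
        ((hb.add hU).intervalIntegrable_dotProduct hT.le (hb.add hU))
  obtain ⟨q, hqw, hq, hqT⟩ := exists_mem_dualSet_of_weak (F := F) (A := A) (H := H) (ℓ := ℓ)
    (w₀ := w₀) hT hw hU (by
      intro x f hs
      have := hpair' hs
      simp only [pairing, dotProduct_zero, add_zero, estimate] at this
      rw [intervalIntegral.integral_add (hw.intervalIntegrable_dotProduct hT.le hs.f_mem)
        (hU.intervalIntegrable_dotProduct hT.le hs.y_mem)]
      simp only [dotProduct_comm (U _)]
      linarith)
  refine ⟨q, ⟨hq, Filter.EventuallyEq.refl _ _⟩, (dualCost_le_rho hT.le hQ₀ hqw hqT).trans ?_⟩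
  rwa [← rho_neg_right, ← rho_congr hT.le (Filter.EventuallyEq.refl _ _) hbU]

theorem exists_dualCost_min (hT : 0 < T) (hQ₀ : Q₀.PosDef) (hQ : Q.PosDef) (hR : R.PosDef)
    (hne : (dualSet F A H ℓ T).Nonempty) :
    ∃ z ∈ dualSet F A H ℓ T, ∀ z' ∈ dualSet F A H ℓ T,
      dualCost F Q₀ Q R T z.1 z.2 ≤ dualCost F Q₀ Q R T z'.1 z'.2 := by
  -- The weak form of the dual system, with the control now unknown as well: noise-free solutions
  -- give linear constraints on `(w₀, w, v)`, in which `v` is paired with `Hx`.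
  let S : Set ((Fin m → ℝ) × (ℝ → Fin m → ℝ) × (ℝ → Fin p → ℝ) × ℝ) :=
    {z | ∃ x f, IsSolution F A H T x f (fun t => H.mulVec (x t)) (fun _ => 0) ∧
      z = (F.mulVec (x 0), f, fun t => H.mulVec (x t), ℓ ⬝ᵥ F.mulVec (x T))}
  let N := pinv F.transpose - mOpt F Q₀
  have hfeas : ∀ z ∈ dualSet F A H ℓ T, ∀ s ∈ S,
      pairing T (N.mulVec (F.transpose.mulVec (z.1 T))) (reversal T z.1) (reversal T z.2)
        s.1 s.2.1 s.2.2.1 = s.2.2.2 := by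
    rintro ⟨q, u⟩ ⟨hq, hq0⟩ _ ⟨x, f, hs, rfl⟩
    simp only at hq hq0
    have hd := hq.duality hT.le hs
    rw [hq0, transpose_mulVec_dotProduct, ← transpose_mulVec_pinv_sub_mOpt F (Q₀ := Q₀) (q T),
      transpose_mulVec_dotProduct] at hd
    rw [pairing, ← hd]
    simp only [N]
    ring
  obtain ⟨⟨q₁, u₁⟩, h₁⟩ := hne
  obtain ⟨w₀, w, v, hw, hv, hwv, hmin⟩ := exists_min_rho_of_pairing_eq hT.le hQ₀ hQ hR S
    (by rintro _ ⟨x, f, hs, rfl⟩; exact ⟨hs.f_mem, hs.y_mem⟩) h₁.1.q_mem.reversal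
    h₁.1.u_mem.reversal (hfeas _ h₁)
  obtain ⟨q, hqw, hq, hqT⟩ := exists_mem_dualSet_of_weak (F := F) (A := A) (H := H) (ℓ := ℓ)
    (w₀ := w₀) hT hw hv fun x f hs => (hwv _ ⟨x, f, hs, rfl⟩).symm
  refine ⟨_, hq, fun z hz => (dualCost_le_rho hT.le hQ₀ hqw hqT).trans
    ((hmin _ _ _ hz.1.q_mem.reversal hz.1.u_mem.reversal (hfeas z hz)).trans_eq ?_)⟩
  rw [rho_reversal, dualCost, rho, rho, dotProduct_barQ₀_mulVec]

theorem worstCaseError_le_dualCost (hT : 0 ≤ T) (hQ₀ : Q₀.PosDef) (hQ : Q.PosDef) (hR : R.PosDef)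
    {z : (ℝ → Fin m → ℝ) × (ℝ → Fin p → ℝ)} (hz : z ∈ dualSetWithInput F A H ℓ T U) :
    worstCaseError F A H Q₀ Q R ℓ T U ≤ (dualCost F Q₀ Q R T z.1 z.2 : EReal) := by
  refine sSup_le ?_
  rintro _ ⟨x, f, y, η, h, rfl⟩
  exact EReal.coe_le_coe_iff.2 (sq_error_le_dualCost hT hQ₀ hQ hR hz h)

theorem worstCaseError_nonneg (hQ : Q.PosDef) (hR : R.PosDef) :
    0 ≤ worstCaseError F A H Q₀ Q R ℓ T U := by
  have ha := (isSolution_noise (F := F) (A := A) (H := H) (T := T) IsL2.zero).isAdmissible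
    (Q₀ := Q₀) hQ hR (by simp [rho])
  refine le_trans ?_ (le_sSup ⟨_, _, _, _, ha, rfl⟩)
  exact EReal.coe_nonneg.2 (sq_nonneg _)

/-- The representation bound is applied with `c` equal to `σ` itself, so the infimum is attained. -/
theorem exists_dualCost_eq_worstCaseError (hT : 0 < T) (hQ₀ : Q₀.PosDef) (hQ : Q.PosDef)
    (hR : R.PosDef) (hU : IsL2 T U) (hσ : worstCaseError F A H Q₀ Q R ℓ T U < ⊤) :
    ∃ z ∈ dualSetWithInput F A H ℓ T U,
      (dualCost F Q₀ Q R T z.1 z.2 : EReal) = worstCaseError F A H Q₀ Q R ℓ T U := by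
  have h0 := worstCaseError_nonneg (F := F) (A := A) (H := H) (ℓ := ℓ) (Q₀ := Q₀) (T := T) (U := U)
    hQ hR
  have hcoe := EReal.coe_toReal hσ.ne (ne_bot_of_le_ne_bot (by simp) h0)
  obtain ⟨q, hq, hle⟩ := exists_dualCost_le_of_worstCaseError_le hT hQ₀ hQ hR hU hcoe.ge
    (EReal.toReal_nonneg h0)
  refine ⟨_, hq, le_antisymm ?_ (worstCaseError_le_dualCost hT.le hQ₀ hQ hR hq)⟩
  rw [← hcoe]
  exact EReal.coe_le_coe_iff.2 hle

theorem worstCaseError_eq_infDualCost (hT : 0 < T) (hQ₀ : Q₀.PosDef) (hQ : Q.PosDef)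
    (hR : R.PosDef) (hU : IsL2 T U) :
    worstCaseError F A H Q₀ Q R ℓ T U =
      infDualCost F Q₀ Q R T (dualSetWithInput F A H ℓ T U) := by
  refine le_antisymm (le_sInf ?_) ?_
  · rintro _ ⟨z, hz, rfl⟩
    exact worstCaseError_le_dualCost hT.le hQ₀ hQ hR hz
  · rcases eq_top_or_lt_top (worstCaseError F A H Q₀ Q R ℓ T U) with h | h
    · rw [h]; exact le_top
    · obtain ⟨z, hz, he⟩ := exists_dualCost_eq_worstCaseError hT hQ₀ hQ hR hU h
      exact sInf_le ⟨z, hz, he.symm⟩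

theorem dualSetWithInput_nonempty_iff (hT : 0 < T) (hQ₀ : Q₀.PosDef) (hQ : Q.PosDef)
    (hR : R.PosDef) (hU : IsL2 T U) :
    (dualSetWithInput F A H ℓ T U).Nonempty ↔ worstCaseError F A H Q₀ Q R ℓ T U < ⊤ := by
  constructor
  · rintro ⟨z, hz⟩
    exact (worstCaseError_le_dualCost hT.le hQ₀ hQ hR hz).trans_lt (EReal.coe_lt_top _)
  · intro h
    obtain ⟨z, hz, -⟩ := exists_dualCost_eq_worstCaseError hT hQ₀ hQ hR hU h
    exact ⟨z, hz⟩

theorem exists_isMinimaxObserver (hT : 0 < T) (hQ₀ : Q₀.PosDef) (hQ : Q.PosDef) (hR : R.PosDef)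
    (hne : (dualSet F A H ℓ T).Nonempty) :
    ∃ U : ℝ → Fin p → ℝ, IsMinimaxObserver F A H Q₀ Q R ℓ T U ∧
      ∃ q u, (q, u) ∈ dualSet F A H ℓ T ∧
        (dualCost F Q₀ Q R T q u : EReal) = infDualCost F Q₀ Q R T (dualSet F A H ℓ T) ∧
        EqAE T U (reversal T u) ∧
        worstCaseError F A H Q₀ Q R ℓ T U = (dualCost F Q₀ Q R T q u : EReal) := by
  obtain ⟨⟨q, u⟩, hz, hmin⟩ := exists_dualCost_min hT hQ₀ hQ hR hne
  have hU := hz.1.u_mem.reversal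
  -- Each `σ(V)` is an infimum of `J` over a subset of the dual set, so the global minimum of `J`
  -- bounds it from below.
  have hge : ∀ V, IsL2 T V →
      (dualCost F Q₀ Q R T q u : EReal) ≤ worstCaseError F A H Q₀ Q R ℓ T V := by
    intro V hV
    rw [worstCaseError_eq_infDualCost hT hQ₀ hQ hR hV]
    refine le_sInf ?_
    rintro _ ⟨z', hz', rfl⟩
    exact EReal.coe_le_coe_iff.2 (hmin z' hz'.1)
  have hσ : worstCaseError F A H Q₀ Q R ℓ T (reversal T u) =
      (dualCost F Q₀ Q R T q u : EReal) := by
    refine le_antisymm (worstCaseError_le_dualCost hT.le hQ₀ hQ hR (z := (q, u)) ⟨hz, ?_⟩)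
      (hge _ hU)
    rw [reversal_reversal]
    exact Filter.EventuallyEq.refl _ _
  refine ⟨reversal T u, ⟨hU, ?_, ?_⟩, q, u, hz, ?_, Filter.EventuallyEq.refl _ _, hσ⟩
  · refine le_antisymm (le_sInf ?_) (sInf_le ⟨_, hU, rfl⟩)
    rintro _ ⟨V, hV, rfl⟩
    rw [hσ]
    exact hge V hV
  · rw [hσ]; exact EReal.coe_lt_top _
  · refine le_antisymm (le_sInf ?_) (sInf_le ⟨(q, u), hz, rfl⟩)
    rintro _ ⟨z', hz', rfl⟩
    exact EReal.coe_le_coe_iff.2 (hmin z' hz')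

end

end MinimaxDAE

theorem theorem1 {m n p : ℕ} (F A : Matrix (Fin m) (Fin n) ℝ) (H : Matrix (Fin p) (Fin n) ℝ)
    (Q₀ Q : Matrix (Fin m) (Fin m) ℝ) (R : Matrix (Fin p) (Fin p) ℝ)
    (hQ₀ : Q₀.PosDef) (hQ : Q.PosDef) (hR : R.PosDef)
    (ℓ : Fin m → ℝ) (t₁ : ℝ) (ht₁ : 0 < t₁) :
    List.TFAE [
      MinimaxDAE.IsImpulseObservable F A H ℓ,
      ∃ U : ℝ → Fin p → ℝ, MinimaxDAE.IsL2 t₁ U ∧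
        MinimaxDAE.worstCaseError F A H Q₀ Q R ℓ t₁ U < ⊤,
      ∃ U : ℝ → Fin p → ℝ, MinimaxDAE.IsMinimaxObserver F A H Q₀ Q R ℓ t₁ U ∧
        ∃ q u, (q, u) ∈ MinimaxDAE.dualSet F A H ℓ t₁ ∧
          (MinimaxDAE.dualCost F Q₀ Q R t₁ q u : EReal) =
            MinimaxDAE.infDualCost F Q₀ Q R t₁ (MinimaxDAE.dualSet F A H ℓ t₁) ∧
          MinimaxDAE.EqAE t₁ U (MinimaxDAE.reversal t₁ u) ∧
          MinimaxDAE.worstCaseError F A H Q₀ Q R ℓ t₁ U =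
            (MinimaxDAE.dualCost F Q₀ Q R t₁ q u : EReal)] ∧
    ∀ U : ℝ → Fin p → ℝ, MinimaxDAE.IsL2 t₁ U →
      MinimaxDAE.worstCaseError F A H Q₀ Q R ℓ t₁ U =
          MinimaxDAE.infDualCost F Q₀ Q R t₁ (MinimaxDAE.dualSetWithInput F A H ℓ t₁ U) ∧
        ((MinimaxDAE.dualSetWithInput F A H ℓ t₁ U).Nonempty ↔
          MinimaxDAE.worstCaseError F A H Q₀ Q R ℓ t₁ U < ⊤) := by
  have hequiv := fun (U : ℝ → Fin p → ℝ) (hU : MinimaxDAE.IsL2 t₁ U) =>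
    MinimaxDAE.dualSetWithInput_nonempty_iff (F := F) (A := A) (H := H) (ℓ := ℓ) ht₁ hQ₀ hQ hR hU
  refine ⟨?_, fun U hU =>
    ⟨MinimaxDAE.worstCaseError_eq_infDualCost ht₁ hQ₀ hQ hR hU, hequiv U hU⟩⟩
  tfae_have 1 → 3 := fun h =>
    MinimaxDAE.exists_isMinimaxObserver ht₁ hQ₀ hQ hR (h.dualSet_nonempty ht₁.le)
  tfae_have 3 → 2 := fun ⟨U, hU, _⟩ => ⟨U, hU.mem, hU.finite⟩
  tfae_have 2 → 1 := fun ⟨U, hU, h⟩ => by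
    obtain ⟨z, hz, -⟩ := (hequiv U hU).2 h
    exact ⟨t₁, ht₁, z, hz⟩
  tfae_finish
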